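/- **Theorem (strongest nonlocal set in $\mathbb{C}^{d_1}\otimes\mathbb{C}^{d_2}\otimes\mathbb{C}^{d_3}\otimes\mathbb{C}^{d_4}$).** Let $2\le d_1<d_2\le d_3\le d_4$, let $N=d_2d_3d_4$ and $\omega_N=e^{2\pi\sqrt{-1}/N}$, and write $|abce\rangle$ for the product computational basis, labels starting at $0$. In all families below the indices are integers; an exclusion "$\setminus\, i=j=k$" removes the index triples with $i=j=k$. - $B_1=\{|1000\rangle,|0001\rangle,|0010\rangle,|0100\rangle\}$ - $B_2=\{\frac1{\sqrt2}(|0ji0\rangle+|i00j\rangle): 1\le i\le d_1-1,\ 1\le j\le d_2-1\}$ - $B_3=\{|0ji0\rangle: d_1\le i\le d_2-1,\ 1\le j\le d_2-1\}$ - $B_4=\{|0ji0\rangle: d_2\le i\le d_3-1,\ d_1\le j\le d_2-1\}$ - $B_5=\{\frac1{\sqrt2}(|0ji0\rangle+|j00i\rangle): d_2\le i\le d_3-1,\ 1\le j\le d_1-1\}$ - $B_6=\{\frac1{\sqrt2}(|0i0j\rangle+|i0j0\rangle): 1\le i\le d_1-1,\ 1\le j\le d_3-1\}$ - $B_7=\{|0i0j\rangle: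 1\le i\le d_1-1,\ d_3\le j\le d_4-1\}$ - $B_8=\{|0i0j\rangle: d_1\le i\le d_2-1,\ 1\le j\le d_4-1\}$ - $B_9=\{\frac1{\sqrt2}(|00ij\rangle+|ij00\rangle): 1\le i\le d_1-1,\ 1\le j\le d_2-1\}$ - $B_{10}=\{|00ij\rangle: 1\le i\le d_1-1,\ d_2\le j\le d_4-1\}$ - $B_{11}=\{|00ij\rangle: d_1\le i\le d_3-1,\ 1\le j\le d_4-1\}$ - $B_{12}=\{\frac1{\sqrt2}(|000i\rangle+|(i-1)(i-1)(i-1)0\rangle): 2\le i\le d_1\}$ - $B_{13}=\{\frac1{\sqrt2}(|00i0\rangle+|(i-1)(i-1)0(i-1)\rangle): 2\le i\le d_1\}$ - $B_{14}=\{\frac1{\sqrt2}(|0i00\rangle+|(i-1)0(i-1)(i-1)\rangle): 2\le i\le d_1\}$ - $B_{15}=\{|000i\rangle: d_1+1\le i\le d_4-1\}$ - $B_{16}=\{|00i0\rangle: d_1+1\le i\le d_3-1\}$ - $B_{17}=\{|0i00\rangle: d_1+1\le i\le d_2-1\}$ - $B_{18}=\{\frac1{\sqrt2}(|0(i-1)(i-1)(i-1)\rangle+|i000\rangle):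 2\le i\le d_1-1\}$ - $B_{19}=\{|0(i-1)(i-1)(i-1)\rangle: d_1\le i\le d_2\}$ - $B_{20}=\{\frac12(|0ijk\rangle+|ijk0\rangle+|jk0i\rangle+|k0ij\rangle): 1\le i,j,k\le d_1-1\ \setminus\ i=j=k\}$ - $B_{21}=\{\frac1{\sqrt3}(|0ijk\rangle+|ijk0\rangle+|jk0i\rangle): 1\le i,j\le d_1-1,\ d_1\le k\le d_2-1\}$ - $B_{22}=\{\frac1{\sqrt3}(|0ijk\rangle+|ijk0\rangle+|k0ij\rangle): 1\le i,k\le d_1-1,\ d_1\le j\le d_2-1\}$ - $B_{23}=\{\frac1{\sqrt3}(|0ijk\rangle+|jk0i\rangle+|k0ij\rangle): d_1\le i\le d_2-1,\ 1\le j,k\le d_1-1\}$ - $B_{24}=\{\frac1{\sqrt3}(|0ijk\rangle+|ijk0\rangle+|i0kj\rangle): 1\le i,j\le d_1-1,\ d_2\le k\le d_3-1\}$ - $B_{25}=\{\frac1{\sqrt3}(|0ijk\rangle+|k0ij\rangle+|ik0j\rangle): 1\le i,k\le d_1-1,\ d_2\le j\le d_3-1\}$ - $B_{26}=\{\frac1{\sqrt3}(|0ijk\rangle+|j0ik\rangle+|ij0k\rangle):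 1\le i,j\le d_1-1,\ d_3\le k\le d_4-1\}$ - $B_{27}=\{\frac1{\sqrt3}(|0ijk\rangle+|i0jk\rangle+|ij0k\rangle): 1\le i\le d_1-1,\ d_1\le j\le d_2-1,\ d_3\le k\le d_4-1\}$ - $B_{28}=\{\frac1{\sqrt2}(|0ijk\rangle+|ijk0\rangle): 1\le i\le d_1-1,\ d_1\le j\le d_2-1,\ d_1\le k\le d_3-1\}$ - $B_{29}=\{\frac1{\sqrt2}(|0ijk\rangle+|k0ij\rangle): d_1\le i\le d_2-1,\ d_1\le j\le d_3-1,\ 1\le k\le d_1-1\}$ - $B_{30}=\{\frac1{\sqrt2}(|0ijk\rangle+|jk0i\rangle): d_1\le i\le d_2-1,\ 1\le j\le d_1-1,\ d_1\le k\le d_2-1\}$ - $B_{31}=\{\frac1{\sqrt2}(|0ijk\rangle+|i0jk\rangle): 1\le i\le d_1-1,\ d_2\le j\le d_3-1,\ d_1\le k\le d_4-1\}$ - $B_{32}=\{\frac1{\sqrt2}(|0ijk\rangle+|ji0k\rangle): d_1\le i\le d_2-1,\ 1\le j\le d_1-1,\ d_2\le k\le d_3-1\}$ - $B_{33}=\{\frac1{\sqrt2}(|0(d_2-1)ij\rangle+|i00j\rangle):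 1\le i\le d_1-1,\ d_3\le j\le d_4-1\}$ - $B_{34}=\{|0ijk\rangle: d_1\le i\le d_2-1,\ d_2\le j\le d_3-1,\ d_1\le k\le d_4-1\}$ - $B_{35}=\{|0ijk\rangle: d_1\le i\le d_2-2,\ 1\le j\le d_1-1,\ d_3\le k\le d_4-1\}$ - $B_{36}=\{|0ijk\rangle: d_1\le i,j\le d_2-1,\ d_1\le k\le d_4-1\ \setminus\ i=j=k\}$ Then $B_1\cup\dots\cup B_{36}$ has exactly $N$ elements, and for every enumeration $\{|\alpha_j\rangle\}_{j=1}^{N}$ of it the set $\{|\psi_i\rangle\}_{i=0}^{N}$, $$|\psi_0\rangle=|0000\rangle,\qquad |\psi_i\rangle=\sum_{j=1}^{N}\omega_N^{ij}|\alpha_j\rangle\quad(1\le i\le N),$$ has exactly $d_2d_3d_4+1$ elements and is strongest nonlocal: its elements are nonzero and mutually orthogonal, and for every nonempty proper subset $S$ of the four parties (in particular for any three parties acting jointly) every orthogonality-preserving local measurement on $S$ is trivial. Here a measurement on $S$ is a finite family of operators $M_m$ on the joint space of $S$ with $\sum_m M_m^\dagger M_m=I$; it is orthogonality-preserving if for each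 $m$ the vectors $(M_m\otimes I)|\psi_i\rangle$ are mutually orthogonal, and trivial if every $M_m^\dagger M_m$ is proportional to $I$. The size $d_2d_3d_4+1$ equals the conjectured lower bound $\max_i\bigl(\prod_{j\ne i}d_j+1\bigr)$ for strongest nonlocal sets. -/

import Mathlib

open scoped BigOperators

noncomputable section

namespace StrongestNonlocality

/-! ### Multipartite pure states and local measurements -/

section Multipartite

variable {P : Type} [Fintype P] [DecidableEq P]

/-- The Hilbert space `⨂ₚ ℂ^(d p)` of a system with parties `p : P` and local dimensions `d p`,
in coordinates with respect to the product computational basis: a vector is its family of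
amplitudes, indexed by the basis labels `x` with `x p ∈ {0, …, d p - 1}`. -/
abbrev Hilb (d : P → ℕ) : Type := EuclideanSpace ℂ ((p : P) → Fin (d p))

/-- The basis labels of the joint subsystem formed by the parties in `S`. -/
abbrev SubIdx (d : P → ℕ) (S : Finset P) : Type := (p : S) → Fin (d p)

/-- Operators on the joint subsystem of the parties in `S`, as matrices in the product basis. -/
abbrev SubOp (d : P → ℕ) (S : Finset P) : Type := Matrix (SubIdx d S) (SubIdx d S) ℂ

/-- The full label which agrees with `y` on `S` and with `x` outside `S`. -/
def glue (d : P → ℕ) (S : Finset P) (y : SubIdx d S) (x : (p : P) → Fin (d p)) :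
    (p : P) → Fin (d p) :=
  fun p => if h : p ∈ S then y ⟨p, h⟩ else x p

/-- The vector `(M ⊗ I) ψ`, where `M` acts on the parties in `S` and the identity acts on all
other parties. -/
def localApply (d : P → ℕ) (S : Finset P) (M : SubOp d S) (ψ : Hilb d) : Hilb d :=
  WithLp.toLp 2 fun x => ∑ y : SubIdx d S, M (fun p => x p) y * ψ (glue d S y x)

/-- The measurement operators `M m` define a POVM `E m = (M m)† (M m)` on the joint subsystem of
the parties in `S`: the (automatically positive semidefinite) operators `E m` sum to `I`. -/
def IsMeasurement (d : P → ℕ) (S : Finset P) {n : ℕ} (M : Fin n → SubOp d S) : Prop :=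
  ∑ m, (M m).conjTranspose * M m = 1

/-- A measurement on the parties in `S` is orthogonality-preserving for the set `Ψ`, if for every
outcome the post-measurement states are still mutually orthogonal. -/
def IsOPLM (d : P → ℕ) (S : Finset P) (Ψ : Set (Hilb d)) {n : ℕ} (M : Fin n → SubOp d S) :
    Prop :=
  IsMeasurement d S M ∧
    ∀ m, Ψ.Pairwise fun φ ψ => inner ℂ (localApply d S (M m) φ) (localApply d S (M m) ψ) = 0

/-- A measurement is trivial if every POVM element is proportional to the identity. -/
def IsTrivialMeasurement (d : P → ℕ) (S : Finset P) {n : ℕ} (M : Fin n → SubOp d S) : Prop :=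
  ∀ m, ∃ c : ℂ, (M m).conjTranspose * M m = c • (1 : SubOp d S)

/-- A set of mutually orthogonal (nonzero, not necessarily normalised) states is strongest
nonlocal if, for every bipartition `S | Sᶜ` of the parties, every orthogonality-preserving
measurement on a side of the bipartition is trivial. As `S` runs over all nonempty proper
subsets, both sides of every bipartition are covered. -/
structure IsStrongestNonlocal (d : P → ℕ) (Ψ : Set (Hilb d)) : Prop where
  ne_zero : ∀ ψ ∈ Ψ, ψ ≠ 0
  orthogonal : Ψ.Pairwise fun φ ψ => inner ℂ φ ψ = 0
  trivial_of_isOPLM : ∀ S : Finset P, S.Nonempty → S ≠ Finset.univ →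
    ∀ (n : ℕ) (M : Fin n → SubOp d S), IsOPLM d S Ψ M → IsTrivialMeasurement d S M

/-- The conjectured lower bound `max_p (D_p + 1)` for the size of a strongest nonlocal set,
where `D_p` is the product of the local dimensions of all parties other than `p`. -/
def conjecturedBound (d : P → ℕ) : ℕ :=
  Finset.univ.sup fun p : P => (∏ q ∈ Finset.univ.erase p, d q) + 1

end Multipartite

/-! ### The four-partite construction -/

/-- The computational basis vector `|a b c e⟩` of a four-partite system (it is the zero vector
if a label is not smaller than the corresponding dimension). -/
def ket {d : Fin 4 → ℕ} (a b c e : ℕ) : Hilb d :=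
  WithLp.toLp 2 fun x =>
    if (x 0 : ℕ) = a ∧ (x 1 : ℕ) = b ∧ (x 2 : ℕ) = c ∧ (x 3 : ℕ) = e then 1 else 0

/-- The normalisation factor `1 / √n`. -/
def invSqrt (n : ℕ) : ℂ := ((Real.sqrt n : ℝ) : ℂ)⁻¹

/-- The families `B₁, …, B₃₆` of states in `ℂ^d₁ ⊗ ℂ^d₂ ⊗ ℂ^d₃ ⊗ ℂ^d₄`. -/
def family (d₁ d₂ d₃ d₄ : ℕ) : ℕ → Set (Hilb ![d₁, d₂, d₃, d₄])
  | 1 => {ket 1 0 0 0, ket 0 0 0 1, ket 0 0 1 0, ket 0 1 0 0}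
  | 2 => {v | ∃ i ∈ Set.Ico 1 d₁, ∃ j ∈ Set.Ico 1 d₂,
      v = invSqrt 2 • (ket 0 j i 0 + ket i 0 0 j)}
  | 3 => {v | ∃ i ∈ Set.Ico d₁ d₂, ∃ j ∈ Set.Ico 1 d₂,
      v = ket 0 j i 0}
  | 4 => {v | ∃ i ∈ Set.Ico d₂ d₃, ∃ j ∈ Set.Ico d₁ d₂,
      v = ket 0 j i 0}
  | 5 => {v | ∃ i ∈ Set.Ico d₂ d₃, ∃ j ∈ Set.Ico 1 d₁,
      v = invSqrt 2 • (ket 0 j i 0 + ket j 0 0 i)}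
  | 6 => {v | ∃ i ∈ Set.Ico 1 d₁, ∃ j ∈ Set.Ico 1 d₃,
      v = invSqrt 2 • (ket 0 i 0 j + ket i 0 j 0)}
  | 7 => {v | ∃ i ∈ Set.Ico 1 d₁, ∃ j ∈ Set.Ico d₃ d₄,
      v = ket 0 i 0 j}
  | 8 => {v | ∃ i ∈ Set.Ico d₁ d₂, ∃ j ∈ Set.Ico 1 d₄,
      v = ket 0 i 0 j}
  | 9 => {v | ∃ i ∈ Set.Ico 1 d₁, ∃ j ∈ Set.Ico 1 d₂,
      v = invSqrt 2 • (ket 0 0 i j + ket i j 0 0)}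
  | 10 => {v | ∃ i ∈ Set.Ico 1 d₁, ∃ j ∈ Set.Ico d₂ d₄,
      v = ket 0 0 i j}
  | 11 => {v | ∃ i ∈ Set.Ico d₁ d₃, ∃ j ∈ Set.Ico 1 d₄,
      v = ket 0 0 i j}
  | 12 => {v | ∃ i ∈ Set.Icc 2 d₁,
      v = invSqrt 2 • (ket 0 0 0 i + ket (i - 1) (i - 1) (i - 1) 0)}
  | 13 => {v | ∃ i ∈ Set.Icc 2 d₁,
      v = invSqrt 2 • (ket 0 0 i 0 + ket (i - 1) (i - 1) 0 (i - 1))}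
  | 14 => {v | ∃ i ∈ Set.Icc 2 d₁,
      v = invSqrt 2 • (ket 0 i 0 0 + ket (i - 1) 0 (i - 1) (i - 1))}
  | 15 => {v | ∃ i ∈ Set.Ico (d₁ + 1) d₄,
      v = ket 0 0 0 i}
  | 16 => {v | ∃ i ∈ Set.Ico (d₁ + 1) d₃,
      v = ket 0 0 i 0}
  | 17 => {v | ∃ i ∈ Set.Ico (d₁ + 1) d₂,
      v = ket 0 i 0 0}
  | 18 => {v | ∃ i ∈ Set.Ico 2 d₁,
      v = invSqrt 2 • (ket 0 (i - 1) (i - 1) (i - 1) + ket i 0 0 0)}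
  | 19 => {v | ∃ i ∈ Set.Icc d₁ d₂,
      v = ket 0 (i - 1) (i - 1) (i - 1)}
  | 20 => {v | ∃ i ∈ Set.Ico 1 d₁, ∃ j ∈ Set.Ico 1 d₁, ∃ k ∈ Set.Ico 1 d₁,
      ¬ (i = j ∧ j = k) ∧ v = invSqrt 4 • (ket 0 i j k + ket i j k 0 + ket j k 0 i + ket k 0 i j)}
  | 21 => {v | ∃ i ∈ Set.Ico 1 d₁, ∃ j ∈ Set.Ico 1 d₁, ∃ k ∈ Set.Ico d₁ d₂,
      v = invSqrt 3 • (ket 0 i j k + ket i j k 0 + ket j k 0 i)}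
  | 22 => {v | ∃ i ∈ Set.Ico 1 d₁, ∃ j ∈ Set.Ico d₁ d₂, ∃ k ∈ Set.Ico 1 d₁,
      v = invSqrt 3 • (ket 0 i j k + ket i j k 0 + ket k 0 i j)}
  | 23 => {v | ∃ i ∈ Set.Ico d₁ d₂, ∃ j ∈ Set.Ico 1 d₁, ∃ k ∈ Set.Ico 1 d₁,
      v = invSqrt 3 • (ket 0 i j k + ket j k 0 i + ket k 0 i j)}
  | 24 => {v | ∃ i ∈ Set.Ico 1 d₁, ∃ j ∈ Set.Ico 1 d₁, ∃ k ∈ Set.Ico d₂ d₃,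
      v = invSqrt 3 • (ket 0 i j k + ket i j k 0 + ket i 0 k j)}
  | 25 => {v | ∃ i ∈ Set.Ico 1 d₁, ∃ j ∈ Set.Ico d₂ d₃, ∃ k ∈ Set.Ico 1 d₁,
      v = invSqrt 3 • (ket 0 i j k + ket k 0 i j + ket i k 0 j)}
  | 26 => {v | ∃ i ∈ Set.Ico 1 d₁, ∃ j ∈ Set.Ico 1 d₁, ∃ k ∈ Set.Ico d₃ d₄,
      v = invSqrt 3 • (ket 0 i j k + ket j 0 i k + ket i j 0 k)}
  | 27 => {v | ∃ i ∈ Set.Ico 1 d₁, ∃ j ∈ Set.Ico d₁ d₂, ∃ k ∈ Set.Ico d₃ d₄,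
      v = invSqrt 3 • (ket 0 i j k + ket i 0 j k + ket i j 0 k)}
  | 28 => {v | ∃ i ∈ Set.Ico 1 d₁, ∃ j ∈ Set.Ico d₁ d₂, ∃ k ∈ Set.Ico d₁ d₃,
      v = invSqrt 2 • (ket 0 i j k + ket i j k 0)}
  | 29 => {v | ∃ i ∈ Set.Ico d₁ d₂, ∃ j ∈ Set.Ico d₁ d₃, ∃ k ∈ Set.Ico 1 d₁,
      v = invSqrt 2 • (ket 0 i j k + ket k 0 i j)}
  | 30 => {v | ∃ i ∈ Set.Ico d₁ d₂, ∃ j ∈ Set.Ico 1 d₁, ∃ k ∈ Set.Ico d₁ d₂,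
      v = invSqrt 2 • (ket 0 i j k + ket j k 0 i)}
  | 31 => {v | ∃ i ∈ Set.Ico 1 d₁, ∃ j ∈ Set.Ico d₂ d₃, ∃ k ∈ Set.Ico d₁ d₄,
      v = invSqrt 2 • (ket 0 i j k + ket i 0 j k)}
  | 32 => {v | ∃ i ∈ Set.Ico d₁ d₂, ∃ j ∈ Set.Ico 1 d₁, ∃ k ∈ Set.Ico d₂ d₃,
      v = invSqrt 2 • (ket 0 i j k + ket j i 0 k)}
  | 33 => {v | ∃ i ∈ Set.Ico 1 d₁, ∃ j ∈ Set.Ico d₃ d₄,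
      v = invSqrt 2 • (ket 0 (d₂ - 1) i j + ket i 0 0 j)}
  | 34 => {v | ∃ i ∈ Set.Ico d₁ d₂, ∃ j ∈ Set.Ico d₂ d₃, ∃ k ∈ Set.Ico d₁ d₄,
      v = ket 0 i j k}
  | 35 => {v | ∃ i ∈ Set.Ico d₁ (d₂ - 1), ∃ j ∈ Set.Ico 1 d₁, ∃ k ∈ Set.Ico d₃ d₄,
      v = ket 0 i j k}
  | 36 => {v | ∃ i ∈ Set.Ico d₁ d₂, ∃ j ∈ Set.Ico d₁ d₂, ∃ k ∈ Set.Ico d₁ d₄,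
      ¬ (i = j ∧ j = k) ∧ v = ket 0 i j k}
  | _ => ∅

/-- The union `B₁ ∪ ⋯ ∪ B₃₆`. -/
def alphaSet (d₁ d₂ d₃ d₄ : ℕ) : Set (Hilb ![d₁, d₂, d₃, d₄]) :=
  ⋃ n ∈ Set.Icc 1 36, family d₁ d₂ d₃ d₄ n

/-- The primitive root of unity `ω_N = exp (2 π √-1 / N)`. -/
def omega (N : ℕ) : ℂ := Complex.exp (2 * Real.pi * Complex.I / N)

/-- The states `ψ₀ = |0000⟩` and `ψᵢ = ∑_{1 ≤ j ≤ N} ω_N^(i j) αⱼ` for `i ≥ 1`. -/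
def psi {d : Fin 4 → ℕ} (N : ℕ) (α : ℕ → Hilb d) (i : ℕ) : Hilb d :=
  if i = 0 then ket 0 0 0 0 else ∑ j ∈ Finset.Icc 1 N, omega N ^ (i * j) • α j

/-- The set `{ψ₀, ψ₁, …, ψ_N}`. -/
def psiSet {d : Fin 4 → ℕ} (N : ℕ) (α : ℕ → Hilb d) : Set (Hilb d) :=
  psi N α '' Set.Icc 0 N

end StrongestNonlocality

end

noncomputable section

namespace StrongestNonlocality

/-! ### Discrete Fourier transform of an orthonormal family -/

section Fourier

open scoped ComplexConjugate

/-! Every state in the families is a normalised uniform superposition over a small class of basis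
labels. Apart from the class `{1000}`, each class contains exactly one label `0bce`, so the triples
`(b, c, e)` index all classes, with `(0, 0, 0)` standing for `{1000}`. This explains the count `d₂ *
d₃ * d₄`. The classes are disjoint, avoid the origin `0000`, cover every other label having a zero
coordinate, and two labels of one class never vanish at the same party.

A proper `S` misses some party `p`. The matrix `G` of `(M ⊗ I)† (M ⊗ I)` is then block diagonal in
the `p`-th label, with identical blocks (`gram_eq_zero`, `gram_update`), so it suffices to know `G`
on the slice where the `p`-th label is `0`. Three steps show that `G` is scalar there.

Origin: orthogonality of the image of `|0000⟩` to the images of all Fourier vectors gives, by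
Fourier inversion, orthogonality to every image of an `α j`. Each class meets the slice at most
once, so the whole row of the origin vanishes off the diagonal (`IsRanked.origin_row`).

Fourier: orthogonality of the transformed vectors makes the Gram matrix of the images of the `α j`
circulant. The class consisting of the single label with `1` at `p` and `0` elsewhere is a translate
of the origin along `p`, so one column of this circulant matrix is already known to vanish off the
diagonal. Hence the matrix is scalar (`inner_map_eq_of_dft_orthogonal`).

Propagation: these relations only control sums of `G` over pairs of classes. Individual entries are
recovered by induction on a rank: the other members of the class of a slice label `x`, moved into
the slice, have smaller rank than `x`, so their rows are known and the row of `x` can be solved for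
(`IsRanked.eq_ite`). The combinatorial facts about the classes, above all `labelRank_lt`, are finite
case distinctions in linear arithmetic. -/

theorem omega_isPrimitiveRoot {N : ℕ} (hN : N ≠ 0) : IsPrimitiveRoot (omega N) N :=
  Complex.isPrimitiveRoot_exp N hN

theorem conj_omega_mul {N : ℕ} (hN : N ≠ 0) : conj (omega N) * omega N = 1 := by
  rw [← Complex.normSq_eq_conj_mul_self, Complex.normSq_eq_norm_sq,
    (omega_isPrimitiveRoot hN).norm'_eq_one hN]
  norm_num

theorem sum_conj_omega_pow_mul {N : ℕ} (hN : N ≠ 0) {j k : ℕ} (hj : j ∈ Finset.Icc 1 N)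
    (hk : k ∈ Finset.Icc 1 N) :
    ∑ i ∈ Finset.Icc 1 N, conj (omega N ^ (i * j)) * omega N ^ (i * k) =
      if j = k then (N : ℂ) else 0 := by
  have hω := omega_isPrimitiveRoot hN
  have hc := conj_omega_mul hN
  split_ifs with h
  · subst h
    have : ∀ i ∈ Finset.Icc 1 N, conj (omega N ^ (i * j)) * omega N ^ (i * j) = 1 := by
      intro i _
      rw [map_pow, ← mul_pow, hc, one_pow]
    rw [Finset.sum_congr rfl this]
    simp
  · set ζ : ℂ := conj (omega N ^ j) * omega N ^ k with hζ
    have hterm : ∀ i ∈ Finset.Icc 1 N,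
        conj (omega N ^ (i * j)) * omega N ^ (i * k) = ζ ^ i := by
      intro i _
      rw [hζ, mul_pow, map_pow, map_pow, ← pow_mul, ← pow_mul, mul_comm j i, mul_comm k i]
    rw [Finset.sum_congr rfl hterm]
    have hζN : ζ ^ N = 1 := by
      rw [hζ, mul_pow, ← map_pow, ← pow_mul, ← pow_mul, mul_comm j, mul_comm k, pow_mul, pow_mul,
        hω.pow_eq_one]
      simp
    have hζ1 : ζ ≠ 1 := by
      intro h1
      apply h
      have : omega N ^ k = omega N ^ j := by
        calc omega N ^ k = (conj (omega N) * omega N) ^ j * omega N ^ k := by rw [hc]; simp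
          _ = omega N ^ j * ζ := by rw [hζ, map_pow]; ring
          _ = omega N ^ j := by rw [h1, mul_one]
      rw [Finset.mem_Icc] at hj hk
      -- Both exponents lie in `1, …, N`, so they differ by less than `N`, and divisibility forces
      -- equality.
      have hmod : (N : ℤ) ∣ k - j := by
        rw [← hω.zpow_eq_one_iff_dvd, zpow_sub₀ (hω.ne_zero hN), zpow_natCast, zpow_natCast, this,
          div_self (pow_ne_zero _ (hω.ne_zero hN))]
      have := Int.eq_zero_of_abs_lt_dvd hmod (by rw [abs_lt]; omega)
      omega
    have hgeom : ∑ i ∈ Finset.range N, ζ ^ i = 0 := by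
      have := mul_neg_geom_sum ζ N
      rw [hζN, sub_self] at this
      exact (mul_eq_zero.mp this).resolve_left (sub_ne_zero.mpr hζ1.symm)
    have : ∑ i ∈ Finset.Icc 1 N, ζ ^ i = ζ * ∑ i ∈ Finset.range N, ζ ^ i := by
      rw [Finset.mul_sum, Finset.range_eq_Ico, ← Finset.Ico_add_one_right_eq_Icc,
        Finset.sum_Ico_eq_sum_range, Finset.range_eq_Ico]
      refine Finset.sum_congr (by simp) fun i _ => ?_
      rw [add_comm, pow_succ']
    rw [this, hgeom, mul_zero]

variable {V W : Type*} [NormedAddCommGroup V] [InnerProductSpace ℂ V] [NormedAddCommGroup W]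
  [InnerProductSpace ℂ W]

/-- The discrete Fourier transform of the family `α 1, …, α N`. -/
def dft (N : ℕ) (α : ℕ → V) (i : ℕ) : V := ∑ j ∈ Finset.Icc 1 N, omega N ^ (i * j) • α j

/-- Fourier inversion, by orthogonality of the characters of `ℤ/N`. -/
theorem sum_conj_omega_smul_dft {N : ℕ} (hN : N ≠ 0) (α : ℕ → V) {j : ℕ}
    (hj : j ∈ Finset.Icc 1 N) :
    ∑ i ∈ Finset.Icc 1 N, conj (omega N ^ (i * j)) • dft N α i = (N : ℂ) • α j := by
  simp only [dft, Finset.smul_sum, smul_smul]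
  rw [Finset.sum_comm]
  simp only [← Finset.sum_smul]
  rw [Finset.sum_eq_single_of_mem j hj]
  · rw [sum_conj_omega_pow_mul hN hj hj, if_pos rfl]
  · intro k hk hkj
    rw [sum_conj_omega_pow_mul hN hj hk, if_neg hkj.symm, zero_smul]

theorem inner_dft {N : ℕ} (hN : N ≠ 0) {α : ℕ → V}
    (hα : ∀ j ∈ Finset.Icc 1 N, ∀ k ∈ Finset.Icc 1 N, inner ℂ (α j) (α k) = if j = k then 1 else 0)
    {i k : ℕ} (hi : i ∈ Finset.Icc 1 N) (hk : k ∈ Finset.Icc 1 N) :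
    inner ℂ (dft N α i) (dft N α k) = if i = k then (N : ℂ) else 0 := by
  rw [← sum_conj_omega_pow_mul hN hi hk]
  simp only [dft, sum_inner, inner_sum, inner_smul_left, inner_smul_right]
  refine Finset.sum_congr rfl fun j hj => ?_
  rw [Finset.sum_eq_single_of_mem j hj, hα j hj j hj, if_pos rfl, mul_one, mul_comm j i,
    mul_comm j k, mul_comm]
  · intro l hl hlj
    rw [hα l hl j hj, if_neg hlj]
    simp

/-- Fourier inversion puts each `α j` in the span of the transformed vectors. It is applied with `w`
the image of the origin vector. -/
theorem inner_eq_zero_of_inner_dft_eq_zero {N : ℕ} (hN : N ≠ 0) {α : ℕ → V} (L : V →ₗ[ℂ] W)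
    (w : W) (h : ∀ i ∈ Finset.Icc 1 N, inner ℂ w (L (dft N α i)) = 0) {j : ℕ}
    (hj : j ∈ Finset.Icc 1 N) : inner ℂ w (L (α j)) = 0 := by
  have h1 : inner ℂ w (L ((N : ℂ) • α j)) = 0 := by
    rw [← sum_conj_omega_smul_dft hN α hj, map_sum, inner_sum]
    refine Finset.sum_eq_zero fun i hi => ?_
    rw [map_smul, inner_smul_right, h i hi, mul_zero]
  rw [map_smul, inner_smul_right] at h1
  exact (mul_eq_zero.mp h1).resolve_left (Nat.cast_ne_zero.mpr hN)

/-- If `L` preserves the orthogonality of the Fourier transform of `α`, and one of the vectors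
`L (α j)` is orthogonal to all others, then the vectors `L (α j)` are mutually orthogonal and
have the same norm. -/
theorem inner_map_eq_of_dft_orthogonal {N : ℕ} (hN : N ≠ 0) {α : ℕ → V} (L : V →ₗ[ℂ] W)
    (h : ∀ i ∈ Finset.Icc 1 N, ∀ k ∈ Finset.Icc 1 N, i ≠ k →
      inner ℂ (L (dft N α i)) (L (dft N α k)) = 0)
    {j₀ : ℕ} (hj₀ : j₀ ∈ Finset.Icc 1 N)
    (h₀ : ∀ j ∈ Finset.Icc 1 N, j ≠ j₀ → inner ℂ (L (α j)) (L (α j₀)) = 0) {j k : ℕ}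
    (hj : j ∈ Finset.Icc 1 N) (hk : k ∈ Finset.Icc 1 N) :
    inner ℂ (L (α j)) (L (α k)) = if j = k then inner ℂ (L (α j₀)) (L (α j₀)) else 0 := by
  have hN' : (N : ℂ) ≠ 0 := Nat.cast_ne_zero.mpr hN
  have hω0 : omega N ≠ 0 := (omega_isPrimitiveRoot hN).ne_zero hN
  set c := inner ℂ (L (α j₀)) (L (α j₀)) with hc
  -- Expand `α j` by Fourier inversion: only the `i`-th transformed vector survives.
  have h1 : ∀ i ∈ Finset.Icc 1 N, ∀ j ∈ Finset.Icc 1 N,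
      (N : ℂ) * inner ℂ (L (dft N α i)) (L (α j)) =
        conj (omega N ^ (i * j)) * inner ℂ (L (dft N α i)) (L (dft N α i)) := by
    intro i hi j hj
    rw [← inner_smul_right, ← map_smul, ← sum_conj_omega_smul_dft hN α hj, map_sum, inner_sum,
      Finset.sum_eq_single_of_mem i hi, map_smul, inner_smul_right]
    intro k hk hki
    rw [map_smul, inner_smul_right, h i hi k hk hki.symm, mul_zero]
  -- Here the transformed vector is expanded instead, and only the term `j₀` survives. Comparison
  -- with `h1` at `j₀` shows that all transformed vectors have images of the same norm.
  have h2 : ∀ i, inner ℂ (L (dft N α i)) (L (α j₀)) = conj (omega N ^ (i * j₀)) * c := by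
    intro i
    rw [dft, map_sum, sum_inner, Finset.sum_eq_single_of_mem j₀ hj₀, map_smul, inner_smul_left]
    intro k hk hkj
    rw [map_smul, inner_smul_left, h₀ k hk hkj, mul_zero]
  have h3 : ∀ i ∈ Finset.Icc 1 N, inner ℂ (L (dft N α i)) (L (dft N α i)) = N * c := by
    intro i hi
    have := h1 i hi j₀ hj₀
    rw [h2] at this
    have hne : conj (omega N ^ (i * j₀)) ≠ 0 :=
      (map_ne_zero _).mpr (pow_ne_zero _ hω0)
    apply mul_left_cancel₀ hne
    rw [← this]
    ring
  have h4 : ∀ i ∈ Finset.Icc 1 N,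
      inner ℂ (L (dft N α i)) (L (α k)) = conj (omega N ^ (i * k)) * c := by
    intro i hi
    apply mul_left_cancel₀ hN'
    rw [h1 i hi k hk, h3 i hi]
    ring
  have h5 : (N : ℂ) * inner ℂ (L (α j)) (L (α k)) = (if j = k then (N : ℂ) else 0) * c := by
    have e : (N : ℂ) = conj (N : ℂ) := by simp
    rw [e, ← inner_smul_left, ← map_smul, ← sum_conj_omega_smul_dft hN α hj, map_sum, sum_inner]
    simp only [← e]
    have hcomm : (if j = k then (N : ℂ) else 0) = if k = j then (N : ℂ) else 0 := by
      simp only [eq_comm]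
    rw [hcomm, ← sum_conj_omega_pow_mul hN hk hj, Finset.sum_mul]
    refine Finset.sum_congr rfl fun i hi => ?_
    rw [map_smul, inner_smul_left, h4 i hi, Complex.conj_conj]
    ring
  apply mul_left_cancel₀ hN'
  rw [h5]
  split_ifs <;> simp

end Fourier

/-! ### Local operators in the product basis -/

section LocalOperators

variable {P : Type} [DecidableEq P] {d : P → ℕ} {S : Finset P}

/-- The restriction of a label to the parties in `S`. -/
def restr (S : Finset P) (x : (p : P) → Fin (d p)) : SubIdx d S := fun p => x p

theorem glue_eq_iff (y : SubIdx d S) (z x : (p : P) → Fin (d p)) :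
    glue d S y z = x ↔ y = restr S x ∧ ∀ p ∉ S, z p = x p := by
  constructor
  · rintro rfl
    refine ⟨?_, ?_⟩
    · ext p
      simp [restr, glue]
    · intro p hp
      simp [glue, hp]
  · rintro ⟨rfl, h⟩
    ext p
    by_cases hp : p ∈ S <;> simp [glue, restr, hp, h]

variable [Fintype P]

/-- The operator `M ⊗ I` as a linear map. -/
def localMap (M : SubOp d S) : Hilb d →ₗ[ℂ] Hilb d where
  toFun := localApply d S M
  map_add' φ ψ := by
    ext x
    simp [localApply, mul_add, Finset.sum_add_distrib]
  map_smul' c φ := by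
    ext x
    simp only [localApply, PiLp.smul_apply, smul_eq_mul, RingHom.id_apply, Finset.mul_sum]
    exact Finset.sum_congr rfl fun y _ => by ring

theorem localMap_single (M : SubOp d S) (x z : (p : P) → Fin (d p)) :
    localMap M (EuclideanSpace.single x 1) z =
      if ∀ p ∉ S, z p = x p then M (restr S z) (restr S x) else 0 := by
  change ∑ y : SubIdx d S, M (restr S z) y * _ = _
  simp only [PiLp.single_apply, glue_eq_iff, mul_ite, mul_one, mul_zero]
  split_ifs with h
  · rw [Finset.sum_eq_single (restr S x) (fun y _ hy => if_neg fun e => hy e.1) (by simp),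
      if_pos ⟨rfl, h⟩]
  · exact Finset.sum_eq_zero fun y _ => if_neg fun e => h e.2

/-- The matrix of `(M ⊗ I)† (M ⊗ I)` in the product basis. -/
def gram (M : SubOp d S) (x x' : (p : P) → Fin (d p)) : ℂ :=
  inner ℂ (localMap M (EuclideanSpace.single x 1)) (localMap M (EuclideanSpace.single x' 1))

/-- `(M ⊗ I)† (M ⊗ I) = M† M ⊗ I`, read entrywise. -/
theorem gram_eq (M : SubOp d S) (x x' : (p : P) → Fin (d p)) :
    gram M x x' = if ∀ p ∉ S, x p = x' p then
      (M.conjTranspose * M) (restr S x) (restr S x') else 0 := by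
  simp only [gram, PiLp.inner_apply, localMap_single]
  split_ifs with h
  · rw [Matrix.mul_apply]
    symm
    -- Only labels agreeing with `x` outside `S` contribute, and `glue` parametrises these by labels
    -- of `S`.
    refine Finset.sum_of_injOn (fun w => glue d S w x) ?_ (by simp) ?_ ?_
    · intro w _ w' _ hw
      have := (glue_eq_iff w x _).mp hw
      rw [this.1]
      ext p
      simp [restr, glue]
    · intro z _ hz
      rw [if_neg, if_neg]
      · simp
      all_goals
        intro hzx
        apply hz
        refine ⟨restr S z, by simp, (glue_eq_iff _ _ _).mpr ⟨rfl, fun p hp => ?_⟩⟩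
      · rw [h p hp, hzx p hp]
      · rw [hzx p hp]
    · intro w _
      obtain ⟨hw, hx⟩ := (glue_eq_iff w x _).mp rfl
      rw [if_pos fun p hp => (hx p hp).symm, if_pos fun p hp => (hx p hp).symm.trans (h p hp), ← hw]
      simp [Matrix.conjTranspose_apply, mul_comm]
  · refine Finset.sum_eq_zero fun z _ => ?_
    by_cases h1 : ∀ p ∉ S, z p = x p
    · rw [if_pos h1, if_neg, inner_zero_right]
      intro h2
      exact h fun p hp => (h1 p hp).symm.trans (h2 p hp)
    · rw [if_neg h1, inner_zero_left]

theorem gram_conj_symm (M : SubOp d S) (x x' : (p : P) → Fin (d p)) :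
    starRingEnd ℂ (gram M x' x) = gram M x x' := inner_conj_symm _ _

theorem gram_eq_zero {M : SubOp d S} {p : P} (hp : p ∉ S) {x x' : (p : P) → Fin (d p)}
    (h : x p ≠ x' p) : gram M x x' = 0 := by
  rw [gram_eq, if_neg]
  exact fun h' => h (h' p hp)

/-- The operator acts as the identity on a party outside `S`, so all diagonal blocks with respect to
that party coincide. -/
theorem gram_update {M : SubOp d S} {p : P} (hp : p ∉ S) {x x' : (p : P) → Fin (d p)}
    (h : x p = x' p) (a : Fin (d p)) :
    gram M (Function.update x p a) (Function.update x' p a) = gram M x x' := by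
  have hr : ∀ x : (p : P) → Fin (d p), restr S (Function.update x p a) = restr S x := by
    intro x
    ext q
    have : (q : P) ≠ p := fun e => hp (e ▸ q.2)
    simp [restr, this]
  rw [gram_eq, gram_eq, hr, hr]
  congr 1
  refine propext (forall₂_congr fun q _ => ?_)
  by_cases hq : q = p
  · subst hq
    simp [h]
  · simp [hq]

/-- The label `o` serves only to fill in the coordinates outside `S`. -/
theorem conjTranspose_mul_self_eq_smul {M : SubOp d S} {c : ℂ} (o : (p : P) → Fin (d p))
    (h : ∀ x x' : (p : P) → Fin (d p), gram M x x' = if x = x' then c else 0) :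
    M.conjTranspose * M = c • (1 : SubOp d S) := by
  ext y y'
  obtain ⟨hy, ho⟩ := (glue_eq_iff y o _).mp rfl
  obtain ⟨hy', ho'⟩ := (glue_eq_iff y' o _).mp rfl
  have := h (glue d S y o) (glue d S y' o)
  rw [gram_eq, if_pos fun p hp => (ho p hp).symm.trans (ho' p hp), ← hy, ← hy'] at this
  rw [this, Matrix.smul_apply, Matrix.one_apply]
  by_cases e : y = y'
  · simp [e]
  · rw [if_neg, if_neg e]
    · simp
    · intro e'
      apply e
      rw [hy, hy', e']

end LocalOperators

/-! ### The propagation argument -/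

section Propagation

variable {P J : Type} [DecidableEq P] {d : P → ℕ}

/-- A family of sets of basis labels such that, for a distinguished party `p` and origin `o`, the
labels of one set which meet the origin at `p` are isolated, and setting the `p`-th label of all
others to the origin decreases the rank. -/
structure IsRanked (C : J → Finset ((p : P) → Fin (d p))) (o : (p : P) → Fin (d p))
    (rank : ((p : P) → Fin (d p)) → ℕ) (p : P) : Prop where
  disjoint : ∀ ⦃j k x⦄, x ∈ C j → x ∈ C k → j = k
  cover : ∀ x, x p = o p → x ≠ o → ∃ j, x ∈ C j
  isolated : ∀ ⦃j x x'⦄, x ∈ C j → x' ∈ C j → x ≠ x' → x p = o p → x' p ≠ o p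
  rank_lt : ∀ ⦃j x x'⦄, x ∈ C j → x' ∈ C j → x ≠ x' → x p = o p →
    rank (Function.update x' p (o p)) < rank x

variable {C : J → Finset ((p : P) → Fin (d p))} {o : (p : P) → Fin (d p)}
  {rank : ((p : P) → Fin (d p)) → ℕ} {p : P}
  {G : ((p : P) → Fin (d p)) → ((p : P) → Fin (d p)) → ℂ}

/-- Within a class, at most one label has the origin's value at `p`. All others are killed by `hG`,
so the sum over the class is a single entry of `G`. -/
theorem IsRanked.origin_row (hC : IsRanked C o rank p)
    (hG : ∀ x x', x p ≠ x' p → G x x' = 0) (h0 : ∀ j, ∑ x ∈ C j, G o x = 0) :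
    ∀ x, x ≠ o → G o x = 0 := by
  intro x hx
  by_cases hxp : x p = o p
  · obtain ⟨j, hj⟩ := hC.cover x hxp hx
    rw [← h0 j, Finset.sum_eq_single_of_mem x hj]
    exact fun x' hx' hne => hG _ _ (hC.isolated hj hx' hne.symm hxp).symm
  · exact hG _ _ (Ne.symm hxp)

variable [Fintype P]

/-- Strong induction on the rank inside the slice `x p = o p`. Once the rows of the other members of
the class of `x` are known, the class sums `horth` and `hdiag` each leave one unknown entry in the
row of `x`. Labels outside the slice are translated into it by `hupd`, which is why labels belonging
to no class cause no difficulty. -/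
theorem IsRanked.eq_ite (hC : IsRanked C o rank p)
    (hG : ∀ x x', x p ≠ x' p → G x x' = 0)
    (hupd : ∀ x x' a, x p = x' p → G (Function.update x p a) (Function.update x' p a) = G x x')
    (hrow : ∀ x, x ≠ o → G o x = 0) (hcol : ∀ x, x ≠ o → G x o = 0)
    (horth : ∀ j k, j ≠ k → ∑ x ∈ C j, ∑ x' ∈ C k, G x x' = 0)
    (hdiag : ∀ j, ∑ x ∈ C j, ∑ x' ∈ C j, G x x' = (C j).card * G o o) :
    ∀ x x', G x x' = if x = x' then G o o else 0 := by
  have lift : ∀ x, (∀ x', G (Function.update x p (o p)) x' =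
      if Function.update x p (o p) = x' then G o o else 0) →
      ∀ x', G x x' = if x = x' then G o o else 0 := by
    intro x hx x'
    by_cases hp : x p = x' p
    · rw [← hupd x x' (o p) hp, hx]
      congr 1
      refine propext ⟨fun h => ?_, fun h => by rw [h]⟩
      ext q
      by_cases hq : q = p
      · subst hq
        rw [hp]
      · simpa [hq] using congrArg Fin.val (congrFun h q)
    · rw [hG _ _ hp, if_neg]
      rintro rfl
      exact hp rfl
  have key : ∀ n x, rank x = n → x p = o p → ∀ x', G x x' = if x = x' then G o o else 0 := by
    intro n
    induction n using Nat.strong_induction_on with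
    | _ n ih =>
    intro x hn hxp x'
    by_cases hxo : x = o
    · subst hxo
      split_ifs with h
      · rw [← h]
      · exact hrow _ (Ne.symm h)
    obtain ⟨j, hj⟩ := hC.cover x hxp hxo
    -- Moving `t` into the slice brings its rank below that of `x`, so the induction hypothesis
    -- applies to the moved label and `lift` carries it back.
    have hother : ∀ t ∈ C j, t ≠ x → ∀ s, G t s = if t = s then G o o else 0 := by
      intro t ht htx
      refine lift t (ih _ (hn ▸ hC.rank_lt hj ht htx.symm hxp) _ rfl (by simp))
    by_cases hx'p : x p = x' p
    swap
    · rw [hG _ _ hx'p, if_neg]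
      rintro rfl
      exact hx'p rfl
    by_cases hx'o : x' = o
    · subst hx'o
      rw [if_neg hxo, hcol _ hxo]
    obtain ⟨k, hk⟩ := hC.cover x' (hx'p ▸ hxp) hx'o
    -- By isolation `y` is the only label of its class in the slice, so it alone contributes to the
    -- row of `x`.
    have hxsum : ∀ k' y, y ∈ C k' → y p = o p → ∑ s ∈ C k', G x s = G x y := by
      intro k' y hy hyp
      refine Finset.sum_eq_single_of_mem y hy fun s hs hsy => hG _ _ ?_
      rw [hxp]
      exact (hC.isolated hy hs hsy.symm hyp).symm
    by_cases hjk : j = k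
    · subst hjk
      obtain rfl : x = x' := by
        by_contra hne
        exact hC.isolated hj hk hne hxp (hx'p ▸ hxp)
      rw [if_pos rfl]
      have h1 := hdiag j
      rw [← Finset.add_sum_erase _ _ hj, hxsum j x hj hxp] at h1
      have h2 : ∑ t ∈ (C j).erase x, ∑ s ∈ C j, G t s = ((C j).card - 1 : ℂ) * G o o := by
        have : ∀ t ∈ (C j).erase x, ∑ s ∈ C j, G t s = G o o := by
          intro t ht
          rw [Finset.mem_erase] at ht
          simp [hother t ht.2 ht.1, ht.2]
        rw [Finset.sum_congr rfl this, Finset.sum_const, Finset.card_erase_of_mem hj,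
          nsmul_eq_mul, Nat.cast_sub (Finset.card_pos.mpr ⟨x, hj⟩), Nat.cast_one]
      rw [h2] at h1
      linear_combination h1
    · have hne : x ≠ x' := fun e => hjk (hC.disjoint hj (e ▸ hk))
      rw [if_neg hne]
      have h1 := horth j k hjk
      rw [← Finset.add_sum_erase _ _ hj, hxsum k x' hk (hx'p ▸ hxp)] at h1
      have h2 : ∑ t ∈ (C j).erase x, ∑ s ∈ C k, G t s = 0 := by
        refine Finset.sum_eq_zero fun t ht => Finset.sum_eq_zero fun s hs => ?_
        rw [Finset.mem_erase] at ht
        rw [hother t ht.2 ht.1, if_neg]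
        rintro rfl
        exact hjk (hC.disjoint ht.2 hs)
      rwa [h2, add_zero] at h1
  exact fun x => lift x (key _ _ rfl (by simp))

end Propagation

/-! ### A criterion for strongest nonlocality -/

section Criterion

open scoped ComplexConjugate

theorem invSqrt_ne_zero {n : ℕ} (hn : n ≠ 0) : invSqrt n ≠ 0 := by
  unfold invSqrt
  have : Real.sqrt n ≠ 0 := by
    rw [Real.sqrt_ne_zero']
    positivity
  exact inv_ne_zero (Complex.ofReal_ne_zero.mpr this)

theorem conj_invSqrt_mul_self {n : ℕ} (hn : n ≠ 0) :
    conj (invSqrt n) * invSqrt n * n = 1 := by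
  have h : (Real.sqrt n : ℂ) * Real.sqrt n = n := by
    rw [← Complex.ofReal_mul, Real.mul_self_sqrt (Nat.cast_nonneg n), Complex.ofReal_natCast]
  have hn' : (Real.sqrt n : ℂ) ≠ 0 := by
    intro h0
    rw [h0, zero_mul] at h
    exact hn (by exact_mod_cast h.symm)
  rw [invSqrt, map_inv₀, Complex.conj_ofReal, ← h]
  field_simp

theorem invSqrt_one : invSqrt 1 = 1 := by simp [invSqrt]

variable {P : Type} [Fintype P] {d : P → ℕ}

/-- The normalised uniform superposition of a set of basis vectors. -/
def uniform (A : Finset ((p : P) → Fin (d p))) : Hilb d :=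
  invSqrt A.card • ∑ x ∈ A, EuclideanSpace.single x 1

theorem inner_map_uniform {W : Type*} [NormedAddCommGroup W] [InnerProductSpace ℂ W]
    (L : Hilb d →ₗ[ℂ] W) (A B : Finset ((p : P) → Fin (d p))) :
    inner ℂ (L (uniform A)) (L (uniform B)) = conj (invSqrt A.card) * invSqrt B.card *
      ∑ x ∈ A, ∑ x' ∈ B,
        inner ℂ (L (EuclideanSpace.single x 1)) (L (EuclideanSpace.single x' 1)) := by
  simp only [uniform, map_smul, map_sum, inner_smul_left, inner_smul_right, sum_inner, inner_sum]
  simp only [← Finset.mul_sum]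
  rw [Finset.sum_comm]
  ring

theorem inner_single_map_uniform {W : Type*} [NormedAddCommGroup W] [InnerProductSpace ℂ W]
    (L : Hilb d →ₗ[ℂ] W) (w : W) (B : Finset ((p : P) → Fin (d p))) :
    inner ℂ w (L (uniform B)) = invSqrt B.card *
      ∑ x ∈ B, inner ℂ w (L (EuclideanSpace.single x 1)) := by
  simp only [uniform, map_smul, map_sum, inner_smul_right, inner_sum]

variable [DecidableEq P]

theorem inner_uniform (A B : Finset ((p : P) → Fin (d p))) :
    inner ℂ (uniform A) (uniform B) =
      conj (invSqrt A.card) * invSqrt B.card * ((A ∩ B).card : ℂ) := by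
  have := inner_map_uniform (LinearMap.id : Hilb d →ₗ[ℂ] Hilb d) A B
  simp only [LinearMap.id_apply, EuclideanSpace.inner_single_left, PiLp.single_apply] at this
  rw [this]
  congr 1
  simp [Finset.sum_ite_eq, Finset.sum_ite_mem]

variable {J : Type} {C : J → Finset ((p : P) → Fin (d p))}

theorem inner_uniform_eq_ite [DecidableEq J] (hne : ∀ j, (C j).Nonempty)
    (hdisj : ∀ ⦃j k x⦄, x ∈ C j → x ∈ C k → j = k) (j k : J) :
    inner ℂ (uniform (C j)) (uniform (C k)) = if j = k then 1 else 0 := by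
  rw [inner_uniform]
  split_ifs with h
  · subst h
    rw [Finset.inter_self, conj_invSqrt_mul_self (Finset.card_ne_zero.mpr (hne j))]
  · have : C j ∩ C k = ∅ := by
      ext x
      simp only [Finset.mem_inter, Finset.notMem_empty, iff_false, not_and]
      exact fun hj hk => h (hdisj hj hk)
    rw [this]
    simp

theorem uniform_injective (hne : ∀ j, (C j).Nonempty)
    (hdisj : ∀ ⦃j k x⦄, x ∈ C j → x ∈ C k → j = k) :
    Function.Injective fun j => uniform (C j) := by
  classical
  intro j k h
  by_contra hjk
  have h1 := inner_uniform_eq_ite hne hdisj j k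
  rw [if_neg hjk] at h1
  have h2 := inner_uniform_eq_ite hne hdisj j j
  rw [if_pos rfl] at h2
  simp only at h
  rw [← h, h2] at h1
  exact one_ne_zero h1

/-- The vector `|o⟩` followed by the Fourier transform of `α 1, …, α N`. -/
def originDft (N : ℕ) (o : (p : P) → Fin (d p)) (α : ℕ → Hilb d) (i : ℕ) : Hilb d :=
  if i = 0 then EuclideanSpace.single o 1 else dft N α i

variable {o : (p : P) → Fin (d p)} {N : ℕ} {α : ℕ → Hilb d}

theorem inner_enumeration (hne : ∀ j, (C j).Nonempty)
    (hdisj : ∀ ⦃j k x⦄, x ∈ C j → x ∈ C k → j = k)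
    (hα : Set.BijOn α (Set.Icc 1 N) (Set.range fun j => uniform (C j))) :
    ∀ j ∈ Finset.Icc 1 N, ∀ k ∈ Finset.Icc 1 N,
      inner ℂ (α j) (α k) = if j = k then 1 else 0 := by
  classical
  intro j hj k hk
  rw [← Finset.mem_coe, Finset.coe_Icc] at hj hk
  obtain ⟨j', hj'⟩ := hα.mapsTo hj
  obtain ⟨k', hk'⟩ := hα.mapsTo hk
  simp only at hj' hk'
  rw [← hj', ← hk', inner_uniform_eq_ite hne hdisj]
  congr 1
  rw [← hα.injOn.eq_iff hj hk, ← hj', ← hk', (uniform_injective hne hdisj).eq_iff.symm]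

theorem inner_originDft (hN : N ≠ 0) (hne : ∀ j, (C j).Nonempty)
    (hdisj : ∀ ⦃j k x⦄, x ∈ C j → x ∈ C k → j = k) (ho : ∀ j, o ∉ C j)
    (hα : Set.BijOn α (Set.Icc 1 N) (Set.range fun j => uniform (C j))) {i k : ℕ}
    (hi : i ∈ Set.Icc 0 N) (hk : k ∈ Set.Icc 0 N) :
    inner ℂ (originDft N o α i) (originDft N o α k) =
      if i = k then (if i = 0 then 1 else (N : ℂ)) else 0 := by
  have h0 : ∀ i ∈ Finset.Icc 1 N, inner ℂ (EuclideanSpace.single o 1) (dft N α i) = (0 : ℂ) := by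
    intro i hi
    rw [dft, inner_sum]
    refine Finset.sum_eq_zero fun j hj => ?_
    rw [← Finset.mem_coe, Finset.coe_Icc] at hj
    obtain ⟨j', hj'⟩ := hα.mapsTo hj
    have := inner_single_map_uniform LinearMap.id (EuclideanSpace.single o (1 : ℂ)) (C j')
    simp only [LinearMap.id_apply] at this hj'
    rw [inner_smul_right, ← hj', this, Finset.sum_eq_zero, mul_zero, mul_zero]
    intro x hx
    rw [EuclideanSpace.inner_single_left, PiLp.single_apply, if_neg, mul_zero]
    rintro rfl
    exact ho _ hx
  simp only [Set.mem_Icc] at hi hk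
  unfold originDft
  by_cases hi0 : i = 0 <;> by_cases hk0 : k = 0
  · simp [hi0, hk0]
  · rw [if_pos hi0, if_neg hk0, if_neg (by omega), h0 k (by rw [Finset.mem_Icc]; omega)]
  · rw [if_neg hi0, if_pos hk0, if_neg (by omega), ← inner_conj_symm,
      h0 i (by rw [Finset.mem_Icc]; omega), map_zero]
  · rw [if_neg hi0, if_neg hk0, if_neg hi0, inner_dft hN (inner_enumeration hne hdisj hα)
      (by rw [Finset.mem_Icc]; omega) (by rw [Finset.mem_Icc]; omega)]

theorem originDft_injOn (hN : N ≠ 0) (hne : ∀ j, (C j).Nonempty)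
    (hdisj : ∀ ⦃j k x⦄, x ∈ C j → x ∈ C k → j = k) (ho : ∀ j, o ∉ C j)
    (hα : Set.BijOn α (Set.Icc 1 N) (Set.range fun j => uniform (C j))) :
    Set.InjOn (originDft N o α) (Set.Icc 0 N) := by
  intro i hi k hk h
  by_contra hik
  have h1 := inner_originDft hN hne hdisj ho hα hi hk
  have h2 := inner_originDft hN hne hdisj ho hα hi hi
  rw [if_neg hik, ← h, h2, if_pos rfl] at h1
  split_ifs at h1 with h0
  · exact one_ne_zero h1
  · exact hN (by exact_mod_cast h1)

theorem ncard_originDft (hN : N ≠ 0) (hne : ∀ j, (C j).Nonempty)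
    (hdisj : ∀ ⦃j k x⦄, x ∈ C j → x ∈ C k → j = k) (ho : ∀ j, o ∉ C j)
    (hα : Set.BijOn α (Set.Icc 1 N) (Set.range fun j => uniform (C j))) :
    (originDft N o α '' Set.Icc 0 N).ncard = N + 1 := by
  rw [(originDft_injOn hN hne hdisj ho hα).ncard_image, ← Finset.coe_Icc,
    Set.ncard_coe_finset]
  simp

/-- The singleton class `C j₀` starts the Fourier argument: its label is the origin translated along
`p`, so its column is obtained from that of the origin. The resulting scalar Gram matrix supplies
the hypotheses of `IsRanked.eq_ite`. -/
theorem conjTranspose_mul_self_of_orthogonal (hN : N ≠ 0) (hne : ∀ j, (C j).Nonempty)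
    {rank : ((p : P) → Fin (d p)) → ℕ} {p : P} (hC : IsRanked C o rank p) {j₀ : J}
    {a : Fin (d p)} (hj₀ : C j₀ = {Function.update o p a})
    (hα : Set.BijOn α (Set.Icc 1 N) (Set.range fun j => uniform (C j))) {S : Finset P}
    (hp : p ∉ S) (M : SubOp d S)
    (h : ∀ i ∈ Set.Icc 0 N, ∀ k ∈ Set.Icc 0 N, i ≠ k →
      inner ℂ (localMap M (originDft N o α i)) (localMap M (originDft N o α k)) = 0) :
    ∃ c : ℂ, M.conjTranspose * M = c • (1 : SubOp d S) := by
  have hsur : ∀ j, ∃ i ∈ Finset.Icc 1 N, α i = uniform (C j) := by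
    intro j
    obtain ⟨i, hi, hij⟩ := hα.surjOn ⟨j, rfl⟩
    exact ⟨i, by rwa [← Finset.coe_Icc, Finset.mem_coe] at hi, hij⟩
  have hψ : ∀ i ∈ Finset.Icc 1 N, originDft N o α i = dft N α i := by
    intro i hi
    rw [Finset.mem_Icc] at hi
    exact if_neg (by omega)
  have hcard : ∀ j, invSqrt (C j).card ≠ 0 := fun j =>
    invSqrt_ne_zero (Finset.card_ne_zero.mpr (hne j))
  have hG : ∀ x x', x p ≠ x' p → gram M x x' = 0 := fun x x' => gram_eq_zero hp
  have hupd : ∀ (x x' : (p : P) → Fin (d p)) (a : Fin (d p)), x p = x' p →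
      gram M (Function.update x p a) (Function.update x' p a) = gram M x x' :=
    fun x x' a hx => gram_update hp hx a
  have h0 : ∀ j, ∑ x ∈ C j, gram M o x = 0 := by
    intro j
    obtain ⟨i, hi, hij⟩ := hsur j
    have h1 := inner_eq_zero_of_inner_dft_eq_zero hN (α := α) (localMap M)
      (localMap M (EuclideanSpace.single o 1)) (fun k hk => by
        rw [← hψ k hk]
        rw [Finset.mem_Icc] at hk
        exact h 0 (by simp) k (by rw [Set.mem_Icc]; omega) (by omega)) hi
    rw [hij, inner_single_map_uniform] at h1
    exact (mul_eq_zero.mp h1).resolve_left (hcard j)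
  have hrow := hC.origin_row hG h0
  have hcol : ∀ x, x ≠ o → gram M x o = 0 := by
    intro x hx
    rw [← gram_conj_symm, hrow x hx, map_zero]
  obtain ⟨i₀, hi₀, hα₀⟩ := hsur j₀
  have hgram : ∀ j k, inner ℂ (localMap M (uniform (C j))) (localMap M (uniform (C k))) =
      conj (invSqrt (C j).card) * invSqrt (C k).card * ∑ x ∈ C j, ∑ x' ∈ C k, gram M x x' :=
    fun j k => inner_map_uniform _ _ _
  have hcol₀ : ∀ i ∈ Finset.Icc 1 N, i ≠ i₀ →
      inner ℂ (localMap M (α i)) (localMap M (α i₀)) = 0 := by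
    intro i hi hne₀
    have hi' := hi
    rw [← Finset.mem_coe, Finset.coe_Icc] at hi'
    obtain ⟨j, hj⟩ := hα.mapsTo hi'
    simp only at hj
    have hjj : j ≠ j₀ := by
      rintro rfl
      rw [← Finset.mem_coe, Finset.coe_Icc] at hi₀
      exact hne₀ (hα.injOn hi' hi₀ (hj.symm.trans hα₀.symm))
    rw [hα₀, ← hj, hgram, Finset.sum_eq_zero, mul_zero]
    intro x hx
    rw [hj₀, Finset.sum_singleton]
    by_cases hxa : x p = a
    -- Translating both labels back along `p` turns the entry into one of the origin's column. The
    -- translate of `x` is not the origin, since otherwise `x` would be the label of `C j₀`.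
    · have hx' : x = Function.update (Function.update x p (o p)) p a := by
        rw [Function.update_idem, ← hxa, Function.update_eq_self]
      rw [hx', hupd _ _ _ (by simp)]
      apply hcol
      intro e
      rw [e] at hx'
      exact hjj (hC.disjoint hx (by rw [hj₀, hx']; simp))
    · exact hG _ _ (by simpa using hxa)
  have hdft : ∀ i ∈ Finset.Icc 1 N, ∀ k ∈ Finset.Icc 1 N, i ≠ k →
      inner ℂ (localMap M (dft N α i)) (localMap M (dft N α k)) = 0 := by
    intro i hi k hk hik
    rw [← hψ i hi, ← hψ k hk]
    rw [Finset.mem_Icc] at hi hk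
    exact h i (by rw [Set.mem_Icc]; omega) k (by rw [Set.mem_Icc]; omega) hik
  have hall := fun {i k : ℕ} (hi : i ∈ Finset.Icc 1 N) (hk : k ∈ Finset.Icc 1 N) =>
    inner_map_eq_of_dft_orthogonal hN (localMap M) hdft hi₀ hcol₀ hi hk
  have hc : inner ℂ (localMap M (α i₀)) (localMap M (α i₀)) = gram M o o := by
    rw [hα₀, hgram, hj₀]
    simp [invSqrt_one, hupd]
  refine ⟨gram M o o, conjTranspose_mul_self_eq_smul o (hC.eq_ite hG hupd hrow hcol ?_ ?_)⟩
  · intro j k hjk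
    obtain ⟨i, hi, hij⟩ := hsur j
    obtain ⟨l, hl, hlk⟩ := hsur k
    have h1 := hall hi hl
    rw [if_neg, hij, hlk, hgram] at h1
    · exact (mul_eq_zero.mp h1).resolve_left
        (mul_ne_zero ((map_ne_zero _).mpr (hcard j)) (hcard k))
    · rintro rfl
      exact hjk (uniform_injective hne hC.disjoint (hij.symm.trans hlk))
  · intro j
    obtain ⟨i, hi, hij⟩ := hsur j
    have h1 := hall hi hi
    have h2 := conj_invSqrt_mul_self (Finset.card_ne_zero.mpr (hne j))
    rw [if_pos rfl, hc, hij, hgram] at h1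
    rw [← h1]
    linear_combination (-∑ x ∈ C j, ∑ x' ∈ C j, gram M x x') * h2

theorem isStrongestNonlocal_originDft (hN : N ≠ 0) (hne : ∀ j, (C j).Nonempty)
    (ho : ∀ j, o ∉ C j) {rank : ((p : P) → Fin (d p)) → ℕ} (hC : ∀ p, IsRanked C o rank p)
    (hdisj : ∀ ⦃j k x⦄, x ∈ C j → x ∈ C k → j = k)
    (hunit : ∀ p, ∃ j a, C j = {Function.update o p a})
    (hα : Set.BijOn α (Set.Icc 1 N) (Set.range fun j => uniform (C j))) :
    IsStrongestNonlocal d (originDft N o α '' Set.Icc 0 N) where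
  ne_zero := by
    rintro _ ⟨i, hi, rfl⟩ h0
    have := inner_originDft hN hne hdisj ho hα hi hi
    rw [if_pos rfl, h0, inner_zero_left] at this
    split_ifs at this with hi0
    · exact one_ne_zero this.symm
    · exact hN (by exact_mod_cast this.symm)
  orthogonal := by
    rintro _ ⟨i, hi, rfl⟩ _ ⟨k, hk, rfl⟩ hik
    rw [inner_originDft hN hne hdisj ho hα hi hk, if_neg]
    rintro rfl
    exact hik rfl
  trivial_of_isOPLM := by
    intro S _ hS n M hM m
    -- A single untouched party is all that the argument needs, so every proper subset is treated
    -- alike.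
    obtain ⟨p, hp⟩ : ∃ p, p ∉ S := by
      by_contra! h
      exact hS (Finset.eq_univ_of_forall h)
    obtain ⟨j₀, a, hj₀⟩ := hunit p
    refine conjTranspose_mul_self_of_orthogonal hN hne (hC p) hj₀ hα hp (M m) ?_
    intro i hi k hk hik
    exact hM.2 m ⟨i, hi, rfl⟩ ⟨k, hk, rfl⟩
      fun e => hik (originDft_injOn hN hne hdisj ho hα hi hk e)

end Criterion

/-! ### The combinatorics of the four-partite construction -/

section Labels

/-- Labels `a b c e` of the vectors of the product basis. -/
abbrev Label : Type := ℕ × ℕ × ℕ × ℕ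

/-- The labels which occur in the state containing `|0bce⟩` when `b`, `c`, `e` are positive and
    not all
equal. -/
def interiorClass (d₁ d₂ d₃ b c e : ℕ) : List Label :=
  if b < d₁ then
    if c < d₁ then
      if e < d₁ then [(0, b, c, e), (b, c, e, 0), (c, e, 0, b), (e, 0, b, c)]
      else if e < d₂ then [(0, b, c, e), (b, c, e, 0), (c, e, 0, b)]
      else if e < d₃ then [(0, b, c, e), (b, c, e, 0), (b, 0, e, c)]
      else [(0, b, c, e), (c, 0, b, e), (b, c, 0, e)]
    else if c < d₂ then
      if e < d₁ then [(0, b, c, e), (b, c, e, 0), (e, 0, b, c)]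
      else if e < d₃ then [(0, b, c, e), (b, c, e, 0)]
      else [(0, b, c, e), (b, 0, c, e), (b, c, 0, e)]
    else if e < d₁ then [(0, b, c, e), (e, 0, b, c), (b, e, 0, c)]
    else [(0, b, c, e), (b, 0, c, e)]
  else if c < d₁ then
    if e < d₁ then [(0, b, c, e), (c, e, 0, b), (e, 0, b, c)]
    else if e < d₂ then [(0, b, c, e), (c, e, 0, b)]
    else if e < d₃ then [(0, b, c, e), (c, b, 0, e)]
    else if b = d₂ - 1 then [(0, b, c, e), (c, 0, 0, e)]
    else [(0, b, c, e)]
  else if e < d₁ then [(0, b, c, e), (e, 0, b, c)]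
  else [(0, b, c, e)]

/-- The labels which occur in the state containing `|0bce⟩`, respectively `|1000⟩` if
`b = c = e = 0`. -/
def labelClass (d₁ d₂ d₃ b c e : ℕ) : List Label :=
  if b = 0 then
    if c = 0 then
      if e = 0 then [(1, 0, 0, 0)]
      else if 2 ≤ e ∧ e ≤ d₁ then [(0, 0, 0, e), (e - 1, e - 1, e - 1, 0)]
      else [(0, 0, 0, e)]
    else if e = 0 then
      if 2 ≤ c ∧ c ≤ d₁ then [(0, 0, c, 0), (c - 1, c - 1, 0, c - 1)] else [(0, 0, c, 0)]
    else if c < d₁ ∧ e < d₂ then [(0, 0, c, e), (c, e, 0, 0)]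
    else [(0, 0, c, e)]
  else if c = 0 then
    if e = 0 then
      if 2 ≤ b ∧ b ≤ d₁ then [(0, b, 0, 0), (b - 1, 0, b - 1, b - 1)] else [(0, b, 0, 0)]
    else if b < d₁ ∧ e < d₃ then [(0, b, 0, e), (b, 0, e, 0)]
    else [(0, b, 0, e)]
  else if e = 0 then
    if c < d₁ then [(0, b, c, 0), (c, 0, 0, b)]
    else if d₂ ≤ c ∧ b < d₁ then [(0, b, c, 0), (b, 0, 0, c)]
    else [(0, b, c, 0)]
  else if b = c ∧ c = e then
    if b + 2 ≤ d₁ then [(0, b, b, b), (b + 1, 0, 0, 0)] else [(0, b, b, b)]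
  else interiorClass d₁ d₂ d₃ b c e

/-- The index `(b, c, e)` of the class which contains a given label. -/
def classIndex (d₁ d₂ d₃ : ℕ) : Label → ℕ × ℕ × ℕ
  | (a, b, c, e) =>
    if a = 0 then (b, c, e)
    else if e = 0 then
      if b = 0 then if c = 0 then (a - 1, a - 1, a - 1) else (a, 0, c)
      else if c = 0 then (0, a, b)
      else if a = b ∧ b = c then (0, 0, a + 1)
      else (a, b, c)
    else if c = 0 then
      if b = 0 then
        if e < d₂ then (e, a, 0) else if e < d₃ then (a, e, 0) else (d₂ - 1, a, e)
      else if a = b ∧ b = e then (0, a + 1, 0)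
      else if e < d₂ then (e, a, b)
      else if e < d₃ then if b < d₁ then (a, e, b) else (b, a, e)
      else (a, b, e)
    else if a = c ∧ c = e then (a + 1, 0, 0)
    else if c < d₁ then if e < d₃ then (c, e, a) else (c, a, e)
    else if c < d₂ then if e < d₃ then (c, e, a) else (a, c, e)
    else if e < d₁ then (a, e, c)
    else (a, c, e)

/-- The indicator function of the nonzero natural numbers. -/
def nonzero (n : ℕ) : ℕ := if n = 0 then 0 else 1

/-- A rank on labels along which the orthogonality relations are propagated. -/
def labelRank : Label → ℕ
  | (a, b, c, e) =>
    6 * max (max a b) (max c e) +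
      2 * (nonzero a + nonzero b + nonzero c + nonzero e) + (nonzero a + nonzero e) / 2

theorem nonzero_of_eq {n : ℕ} (h : n = 0) : nonzero n = 0 := if_pos h

theorem nonzero_of_ne {n : ℕ} (h : n ≠ 0) : nonzero n = 1 := if_neg h

variable {d₁ d₂ d₃ d₄ b c e : ℕ}

/-- A label determines its class; this yields disjointness of the classes. -/
theorem classIndex_of_mem (h₁ : 2 ≤ d₁) (h₁₂ : d₁ < d₂) (h₂₃ : d₂ ≤ d₃) (hb : b < d₂)
    (hc : c < d₃) {t : Label} (ht : t ∈ labelClass d₁ d₂ d₃ b c e) :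
    classIndex d₁ d₂ d₃ t = (b, c, e) := by
  unfold labelClass at ht
  split_ifs at ht
  all_goals try (unfold interiorClass at ht; split_ifs at ht)
  all_goals
    simp only [List.mem_cons, List.not_mem_nil, or_false] at ht
    rcases ht with rfl | rfl | rfl | rfl <;>
    simp (disch := omega) only [classIndex, if_pos, if_neg, if_true, and_self] <;>
    simp only [Prod.mk.injEq, true_and, and_true] <;> omega

theorem labelClass_lt (h₁ : 2 ≤ d₁) (h₁₂ : d₁ < d₂) (h₂₃ : d₂ ≤ d₃) (h₃₄ : d₃ ≤ d₄) (hb : b < d₂)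
    (hc : c < d₃) (he : e < d₄) {t : Label} (ht : t ∈ labelClass d₁ d₂ d₃ b c e) :
    t.1 < d₁ ∧ t.2.1 < d₂ ∧ t.2.2.1 < d₃ ∧ t.2.2.2 < d₄ ∧ t ≠ (0, 0, 0, 0) := by
  unfold labelClass at ht
  split_ifs at ht
  all_goals try (unfold interiorClass at ht; split_ifs at ht)
  all_goals
    simp only [List.mem_cons, List.not_mem_nil, or_false] at ht
    rcases ht with rfl | rfl | rfl | rfl <;>
    simp only [ne_eq, Prod.mk.injEq] <;> omega

theorem nodup_labelClass (h₁ : 2 ≤ d₁) (h₁₂ : d₁ < d₂) : (labelClass d₁ d₂ d₃ b c e).Nodup := by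
  unfold labelClass
  split_ifs
  all_goals try (unfold interiorClass; split_ifs)
  all_goals
    simp only [List.nodup_cons, List.mem_cons, List.not_mem_nil, or_false, not_or, Prod.mk.injEq,
      List.nodup_nil, not_false_eq_true, and_true] <;> omega

/-- The zero sets of distinct members of a class are disjoint, as seen by inspecting the cases. Most
classes consist of permutations of one label, chosen so that the zeros move to new positions. -/
theorem labelClass_isolated (h₁ : 2 ≤ d₁) (h₁₂ : d₁ < d₂) {s t : Label}
    (hs : s ∈ labelClass d₁ d₂ d₃ b c e) (ht : t ∈ labelClass d₁ d₂ d₃ b c e) (hst : s ≠ t) :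
    (s.1 = 0 → t.1 ≠ 0) ∧ (s.2.1 = 0 → t.2.1 ≠ 0) ∧ (s.2.2.1 = 0 → t.2.2.1 ≠ 0) ∧
      (s.2.2.2 = 0 → t.2.2.2 ≠ 0) := by
  unfold labelClass at hs ht
  split_ifs at hs ht
  all_goals try (unfold interiorClass at hs ht; split_ifs at hs ht)
  all_goals
    simp only [List.mem_cons, List.not_mem_nil, or_false] at hs ht
    rcases hs with rfl | rfl | rfl | rfl <;> rcases ht with rfl | rfl | rfl | rfl <;>
    first
    | exact absurd rfl hst
    | (clear hst; simp only; omega)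

set_option maxHeartbeats 2000000 in
-- In most classes the members are permutations of each other: deleting a nonzero entry of `t` does
-- not raise the maximum and lowers the number of nonzero entries, which outweighs the last summand
-- of the rank. In the classes pairing a one-entry label with a label having three equal entries,
-- the maximum drops; the factor `6` beats a gain of at most two nonzero entries plus the last
-- summand. That summand exists for the pair `(0, d₂ - 1, c, e)`, `(c, 0, 0, e)`: deleting an entry
-- of the former can give `(0, 0, c, e)` or `(0, d₂ - 1, 0, e)`, which tie with `(c, 0, 0, e)` in
-- maximum and count but have first entry zero.
theorem labelRank_lt (h₁ : 2 ≤ d₁) (h₁₂ : d₁ < d₂) {s t : Label}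
    (hs : s ∈ labelClass d₁ d₂ d₃ b c e) (ht : t ∈ labelClass d₁ d₂ d₃ b c e) (hst : s ≠ t) :
    (s.1 = 0 → labelRank (0, t.2) < labelRank s) ∧
    (s.2.1 = 0 → labelRank (t.1, 0, t.2.2) < labelRank s) ∧
    (s.2.2.1 = 0 → labelRank (t.1, t.2.1, 0, t.2.2.2) < labelRank s) ∧
    (s.2.2.2 = 0 → labelRank (t.1, t.2.1, t.2.2.1, 0) < labelRank s) := by
  unfold labelClass at hs ht
  split_ifs at hs ht
  all_goals try (unfold interiorClass at hs ht; split_ifs at hs ht)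
  all_goals
    simp only [List.mem_cons, List.not_mem_nil, or_false] at hs ht
    rcases hs with rfl | rfl | rfl | rfl <;> rcases ht with rfl | rfl | rfl | rfl <;>
    first
    | exact absurd rfl hst
    | (clear hst; refine ⟨?_, ?_, ?_, ?_⟩ <;> intro h <;> simp only at h <;>
        first
        | (exfalso; omega)
        | (simp (disch := omega) only [labelRank, nonzero_of_eq, nonzero_of_ne]; omega))

theorem zero_mem_labelClass (h : (b, c, e) ≠ (0, 0, 0)) :
    (0, b, c, e) ∈ labelClass d₁ d₂ d₃ b c e := by
  simp only [ne_eq, Prod.mk.injEq] at h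
  unfold labelClass
  split_ifs
  all_goals try (unfold interiorClass; split_ifs)
  all_goals
    simp only [List.mem_cons, List.not_mem_nil, or_false, Prod.mk.injEq, true_and, and_true,
      true_or] <;> omega

set_option maxHeartbeats 2000000 in
theorem exists_mem_labelClass (h₁ : 2 ≤ d₁) (h₁₂ : d₁ < d₂) (h₂₃ : d₂ ≤ d₃) (h₃₄ : d₃ ≤ d₄)
    {a : ℕ} (h : (a, b, c, e) ≠ (0, 0, 0, 0)) (ha : a < d₁) (hb : b < d₂) (hc : c < d₃)
    (he : e < d₄) (h0 : a = 0 ∨ b = 0 ∨ c = 0 ∨ e = 0) :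
    ∃ b' < d₂, ∃ c' < d₃, ∃ e' < d₄, (a, b, c, e) ∈ labelClass d₁ d₂ d₃ b' c' e' := by
  by_cases ha0 : a = 0
  · subst ha0
    refine ⟨b, hb, c, hc, e, he, zero_mem_labelClass ?_⟩
    simpa using h
  clear h
  -- The extra equation makes the witnesses come from `classIndex` by unification after the case
  -- split.
  suffices ∃ b' < d₂, ∃ c' < d₃, ∃ e' < d₄, classIndex d₁ d₂ d₃ (a, b, c, e) = (b', c', e') ∧
      (a, b, c, e) ∈ labelClass d₁ d₂ d₃ b' c' e' by
    obtain ⟨b', hb', c', hc', e', he', -, h⟩ := this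
    exact ⟨b', hb', c', hc', e', he', h⟩
  simp only [classIndex, if_neg ha0]
  split_ifs <;> refine ⟨_, ?_, _, ?_, _, ?_, rfl, ?_⟩
  all_goals first
    | omega
    | (simp (disch := omega) only [labelClass, interiorClass, if_pos, if_neg, if_true, and_self]
       try split_ifs
       all_goals
         simp only [List.mem_cons, List.not_mem_nil, or_false, Prod.mk.injEq, true_and, and_true]
         omega)

end Labels

/-! ### The families as a single indexed family -/

section States

variable {d₁ d₂ d₃ d₄ b c e : ℕ}

/-- The normalised superposition of a list of vectors of the product basis. -/
def labelState {d : Fin 4 → ℕ} (l : List Label) : Hilb d :=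
  invSqrt l.length • (l.map fun t => ket t.1 t.2.1 t.2.2.1 t.2.2.2).sum

theorem labelState_singleton {d : Fin 4 → ℕ} (a b c e : ℕ) :
    (labelState [(a, b, c, e)] : Hilb d) = ket a b c e := by
  simp [labelState, invSqrt_one]

theorem labelState_pair {d : Fin 4 → ℕ} (s t : Label) : (labelState [s, t] : Hilb d) =
    invSqrt 2 • (ket s.1 s.2.1 s.2.2.1 s.2.2.2 + ket t.1 t.2.1 t.2.2.1 t.2.2.2) := by
  simp [labelState]

theorem labelState_triple {d : Fin 4 → ℕ} (s t u : Label) : (labelState [s, t, u] : Hilb d) =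
    invSqrt 3 • (ket s.1 s.2.1 s.2.2.1 s.2.2.2 + ket t.1 t.2.1 t.2.2.1 t.2.2.2 +
      ket u.1 u.2.1 u.2.2.1 u.2.2.2) := by
  simp [labelState, add_assoc]

theorem labelState_quadruple {d : Fin 4 → ℕ} (s t u w : Label) :
    (labelState [s, t, u, w] : Hilb d) =
      invSqrt 4 • (ket s.1 s.2.1 s.2.2.1 s.2.2.2 + ket t.1 t.2.1 t.2.2.1 t.2.2.2 +
        ket u.1 u.2.1 u.2.2.1 u.2.2.2 + ket w.1 w.2.1 w.2.2.1 w.2.2.2) := by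
  simp [labelState, add_assoc]

theorem mem_alphaSet_of_family {n : ℕ} (hn : n ∈ Set.Icc 1 36)
    {v : Hilb ![d₁, d₂, d₃, d₄]} (hv : v ∈ family d₁ d₂ d₃ d₄ n) : v ∈ alphaSet d₁ d₂ d₃ d₄ :=
  Set.mem_biUnion hn hv

theorem labelState_mem_alphaSet_one {l : List Label} (hl : l ∈ [[(1, 0, 0, 0)], [(0, 0, 0, 1)],
    [(0, 0, 1, 0)], [(0, 1, 0, 0)]]) : labelState l ∈ alphaSet d₁ d₂ d₃ d₄ := by
  refine mem_alphaSet_of_family (n := 1) (by simp) ?_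
  simp only [List.mem_cons, List.not_mem_nil, or_false] at hl
  rcases hl with rfl | rfl | rfl | rfl <;> simp [labelState_singleton, family]

theorem interiorClass_state_mem (h₁₂ : d₁ < d₂)
    (hb : b < d₂) (hc : c < d₃) (he : e < d₄) (hb0 : b ≠ 0) (hc0 : c ≠ 0) (he0 : e ≠ 0)
    (hne : ¬(b = c ∧ c = e)) :
    labelState (interiorClass d₁ d₂ d₃ b c e) ∈ alphaSet d₁ d₂ d₃ d₄ := by
  unfold interiorClass
  split_ifs
  · exact mem_alphaSet_of_family (n := 20) (by simp)
      ⟨b, ⟨by omega, by omega⟩, c, ⟨by omega, by omega⟩, e, ⟨by omega, by omega⟩, by omega,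
        labelState_quadruple _ _ _ _⟩
  · exact mem_alphaSet_of_family (n := 21) (by simp)
      ⟨b, ⟨by omega, by omega⟩, c, ⟨by omega, by omega⟩, e, ⟨by omega, by omega⟩,
        labelState_triple _ _ _⟩
  · exact mem_alphaSet_of_family (n := 24) (by simp)
      ⟨b, ⟨by omega, by omega⟩, c, ⟨by omega, by omega⟩, e, ⟨by omega, by omega⟩,
        labelState_triple _ _ _⟩
  · exact mem_alphaSet_of_family (n := 26) (by simp)
      ⟨b, ⟨by omega, by omega⟩, c, ⟨by omega, by omega⟩, e, ⟨by omega, by omega⟩,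
        labelState_triple _ _ _⟩
  · exact mem_alphaSet_of_family (n := 22) (by simp)
      ⟨b, ⟨by omega, by omega⟩, c, ⟨by omega, by omega⟩, e, ⟨by omega, by omega⟩,
        labelState_triple _ _ _⟩
  · exact mem_alphaSet_of_family (n := 28) (by simp)
      ⟨b, ⟨by omega, by omega⟩, c, ⟨by omega, by omega⟩, e, ⟨by omega, by omega⟩,
        labelState_pair _ _⟩
  · exact mem_alphaSet_of_family (n := 27) (by simp)
      ⟨b, ⟨by omega, by omega⟩, c, ⟨by omega, by omega⟩, e, ⟨by omega, by omega⟩,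
        labelState_triple _ _ _⟩
  · exact mem_alphaSet_of_family (n := 25) (by simp)
      ⟨b, ⟨by omega, by omega⟩, c, ⟨by omega, by omega⟩, e, ⟨by omega, by omega⟩,
        labelState_triple _ _ _⟩
  · exact mem_alphaSet_of_family (n := 31) (by simp)
      ⟨b, ⟨by omega, by omega⟩, c, ⟨by omega, by omega⟩, e, ⟨by omega, by omega⟩,
        labelState_pair _ _⟩
  · exact mem_alphaSet_of_family (n := 23) (by simp)
      ⟨b, ⟨by omega, by omega⟩, c, ⟨by omega, by omega⟩, e, ⟨by omega, by omega⟩,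
        labelState_triple _ _ _⟩
  · exact mem_alphaSet_of_family (n := 30) (by simp)
      ⟨b, ⟨by omega, by omega⟩, c, ⟨by omega, by omega⟩, e, ⟨by omega, by omega⟩,
        labelState_pair _ _⟩
  · exact mem_alphaSet_of_family (n := 32) (by simp)
      ⟨b, ⟨by omega, by omega⟩, c, ⟨by omega, by omega⟩, e, ⟨by omega, by omega⟩,
        labelState_pair _ _⟩
  · exact mem_alphaSet_of_family (n := 33) (by simp)
      -- Here `b = d₂ - 1`, so this family has only two parameters.
      ⟨c, ⟨by omega, by omega⟩, e, ⟨by omega, by omega⟩, by simp [labelState_pair, *]⟩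
  · exact mem_alphaSet_of_family (n := 35) (by simp)
      ⟨b, ⟨by omega, by omega⟩, c, ⟨by omega, by omega⟩, e, ⟨by omega, by omega⟩,
        labelState_singleton _ _ _ _⟩
  · exact mem_alphaSet_of_family (n := 29) (by simp)
      ⟨b, ⟨by omega, by omega⟩, c, ⟨by omega, by omega⟩, e, ⟨by omega, by omega⟩,
        labelState_pair _ _⟩
  -- One branch of the class definition covers two families, separated by the size of `c`.
  · by_cases h : c < d₂
    · exact mem_alphaSet_of_family (n := 36) (by simp)
        ⟨b, ⟨by omega, by omega⟩, c, ⟨by omega, by omega⟩, e, ⟨by omega, by omega⟩, by omega,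
          labelState_singleton _ _ _ _⟩
    · exact mem_alphaSet_of_family (n := 34) (by simp)
        ⟨b, ⟨by omega, by omega⟩, c, ⟨by omega, by omega⟩, e, ⟨by omega, by omega⟩,
          labelState_singleton _ _ _ _⟩

theorem labelClass_state_mem (h₁ : 2 ≤ d₁) (h₁₂ : d₁ < d₂) (h₂₃ : d₂ ≤ d₃)
    (hb : b < d₂) (hc : c < d₃) (he : e < d₄) :
    labelState (labelClass d₁ d₂ d₃ b c e) ∈ alphaSet d₁ d₂ d₃ d₄ := by
  unfold labelClass
  split_ifs
  · exact labelState_mem_alphaSet_one (by simp [*])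
  · exact mem_alphaSet_of_family (n := 12) (by simp)
      ⟨e, ⟨by omega, by omega⟩, labelState_pair _ _⟩
  · by_cases h : e = 1
    · exact labelState_mem_alphaSet_one (by simp [*])
    · exact mem_alphaSet_of_family (n := 15) (by simp)
        ⟨e, ⟨by omega, by omega⟩, labelState_singleton _ _ _ _⟩
  · exact mem_alphaSet_of_family (n := 13) (by simp)
      ⟨c, ⟨by omega, by omega⟩, labelState_pair _ _⟩
  · by_cases h : c = 1
    · exact labelState_mem_alphaSet_one (by simp [*])
    · exact mem_alphaSet_of_family (n := 16) (by simp)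
        ⟨c, ⟨by omega, by omega⟩, labelState_singleton _ _ _ _⟩
  · exact mem_alphaSet_of_family (n := 9) (by simp)
      ⟨c, ⟨by omega, by omega⟩, e, ⟨by omega, by omega⟩, labelState_pair _ _⟩
  · by_cases h : c < d₁
    · exact mem_alphaSet_of_family (n := 10) (by simp)
        ⟨c, ⟨by omega, by omega⟩, e, ⟨by omega, by omega⟩, labelState_singleton _ _ _ _⟩
    · exact mem_alphaSet_of_family (n := 11) (by simp)
        ⟨c, ⟨by omega, by omega⟩, e, ⟨by omega, by omega⟩, labelState_singleton _ _ _ _⟩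
  · exact mem_alphaSet_of_family (n := 14) (by simp)
      ⟨b, ⟨by omega, by omega⟩, labelState_pair _ _⟩
  · by_cases h : b = 1
    · exact labelState_mem_alphaSet_one (by simp [*])
    · exact mem_alphaSet_of_family (n := 17) (by simp)
        ⟨b, ⟨by omega, by omega⟩, labelState_singleton _ _ _ _⟩
  · exact mem_alphaSet_of_family (n := 6) (by simp)
      ⟨b, ⟨by omega, by omega⟩, e, ⟨by omega, by omega⟩, labelState_pair _ _⟩
  · by_cases h : b < d₁
    · exact mem_alphaSet_of_family (n := 7) (by simp)
        ⟨b, ⟨by omega, by omega⟩, e, ⟨by omega, by omega⟩, labelState_singleton _ _ _ _⟩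
    · exact mem_alphaSet_of_family (n := 8) (by simp)
        ⟨b, ⟨by omega, by omega⟩, e, ⟨by omega, by omega⟩, labelState_singleton _ _ _ _⟩
  · exact mem_alphaSet_of_family (n := 2) (by simp)
      -- The families of states `|0ji0⟩` list the third label before the second.
      ⟨c, ⟨by omega, by omega⟩, b, ⟨by omega, by omega⟩, labelState_pair _ _⟩
  · exact mem_alphaSet_of_family (n := 5) (by simp)
      ⟨c, ⟨by omega, by omega⟩, b, ⟨by omega, by omega⟩, labelState_pair _ _⟩
  · by_cases h : c < d₂
    · exact mem_alphaSet_of_family (n := 3) (by simp)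
        ⟨c, ⟨by omega, by omega⟩, b, ⟨by omega, by omega⟩, labelState_singleton _ _ _ _⟩
    · exact mem_alphaSet_of_family (n := 4) (by simp)
        ⟨c, ⟨by omega, by omega⟩, b, ⟨by omega, by omega⟩, labelState_singleton _ _ _ _⟩
  · exact mem_alphaSet_of_family (n := 18) (by simp)
      -- The family's index is one more than the repeated label.
      ⟨b + 1, ⟨by omega, by omega⟩, labelState_pair _ _⟩
  · exact mem_alphaSet_of_family (n := 19) (by simp)
      ⟨b + 1, ⟨by omega, by omega⟩, labelState_singleton _ _ _ _⟩
  · exact interiorClass_state_mem h₁₂ hb hc he (by assumption) (by assumption) (by assumption)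
      (by assumption)

set_option maxHeartbeats 4000000 in
theorem exists_labelClass_of_mem (h₁ : 2 ≤ d₁) (h₁₂ : d₁ < d₂) (h₂₃ : d₂ ≤ d₃) (h₃₄ : d₃ ≤ d₄)
    {v : Hilb ![d₁, d₂, d₃, d₄]} (hv : v ∈ alphaSet d₁ d₂ d₃ d₄) :
    ∃ b < d₂, ∃ c < d₃, ∃ e < d₄, v = labelState (labelClass d₁ d₂ d₃ b c e) := by
  obtain ⟨n, ⟨hn, hn'⟩, hv⟩ := Set.mem_iUnion₂.mp hv
  interval_cases n
  · rcases hv with rfl | rfl | rfl | rfl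
    · exact ⟨0, by omega, 0, by omega, 0, by omega, by simp [labelClass, labelState_singleton]⟩
    · exact ⟨0, by omega, 0, by omega, 1, by omega, by simp [labelClass, labelState_singleton]⟩
    · exact ⟨0, by omega, 1, by omega, 0, by omega, by simp [labelClass, labelState_singleton]⟩
    · exact ⟨1, by omega, 0, by omega, 0, by omega, by simp [labelClass, labelState_singleton]⟩
  · obtain ⟨i, ⟨hi, hi'⟩, j, ⟨hj, hj'⟩, rfl⟩ := hv
    refine ⟨j, by omega, i, by omega, 0, by omega, ?_⟩
    simp (disch := omega) only [labelClass, ↓if_pos, ↓if_neg]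
    rw [labelState_pair]
  · obtain ⟨i, ⟨hi, hi'⟩, j, ⟨hj, hj'⟩, rfl⟩ := hv
    refine ⟨j, by omega, i, by omega, 0, by omega, ?_⟩
    simp (disch := omega) only [labelClass, ↓if_pos, ↓if_neg]
    rw [labelState_singleton]
  · obtain ⟨i, ⟨hi, hi'⟩, j, ⟨hj, hj'⟩, rfl⟩ := hv
    refine ⟨j, by omega, i, by omega, 0, by omega, ?_⟩
    simp (disch := omega) only [labelClass, ↓if_pos, ↓if_neg]
    rw [labelState_singleton]
  · obtain ⟨i, ⟨hi, hi'⟩, j, ⟨hj, hj'⟩, rfl⟩ := hv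
    refine ⟨j, by omega, i, by omega, 0, by omega, ?_⟩
    simp (disch := omega) only [labelClass, ↓if_pos, ↓if_neg]
    rw [labelState_pair]
  · obtain ⟨i, ⟨hi, hi'⟩, j, ⟨hj, hj'⟩, rfl⟩ := hv
    refine ⟨i, by omega, 0, by omega, j, by omega, ?_⟩
    simp (disch := omega) only [labelClass, ↓if_pos, ↓if_neg]
    rw [labelState_pair]
  · obtain ⟨i, ⟨hi, hi'⟩, j, ⟨hj, hj'⟩, rfl⟩ := hv
    refine ⟨i, by omega, 0, by omega, j, by omega, ?_⟩
    simp (disch := omega) only [labelClass, ↓if_pos, ↓if_neg]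
    rw [labelState_singleton]
  · obtain ⟨i, ⟨hi, hi'⟩, j, ⟨hj, hj'⟩, rfl⟩ := hv
    refine ⟨i, by omega, 0, by omega, j, by omega, ?_⟩
    simp (disch := omega) only [labelClass, ↓if_pos, ↓if_neg]
    rw [labelState_singleton]
  · obtain ⟨i, ⟨hi, hi'⟩, j, ⟨hj, hj'⟩, rfl⟩ := hv
    refine ⟨0, by omega, i, by omega, j, by omega, ?_⟩
    simp (disch := omega) only [labelClass, ↓if_pos, ↓if_neg]
    rw [labelState_pair]
  · obtain ⟨i, ⟨hi, hi'⟩, j, ⟨hj, hj'⟩, rfl⟩ := hv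
    refine ⟨0, by omega, i, by omega, j, by omega, ?_⟩
    simp (disch := omega) only [labelClass, ↓if_pos, ↓if_neg]
    rw [labelState_singleton]
  · obtain ⟨i, ⟨hi, hi'⟩, j, ⟨hj, hj'⟩, rfl⟩ := hv
    refine ⟨0, by omega, i, by omega, j, by omega, ?_⟩
    simp (disch := omega) only [labelClass, ↓if_pos, ↓if_neg]
    rw [labelState_singleton]
  · obtain ⟨i, ⟨hi, hi'⟩, rfl⟩ := hv
    refine ⟨0, by omega, 0, by omega, i, by omega, ?_⟩
    simp (disch := omega) only [labelClass, ↓if_pos, ↓if_neg]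
    rw [labelState_pair]
  · obtain ⟨i, ⟨hi, hi'⟩, rfl⟩ := hv
    refine ⟨0, by omega, i, by omega, 0, by omega, ?_⟩
    simp (disch := omega) only [labelClass, ↓if_pos, ↓if_neg]
    rw [labelState_pair]
  · obtain ⟨i, ⟨hi, hi'⟩, rfl⟩ := hv
    refine ⟨i, by omega, 0, by omega, 0, by omega, ?_⟩
    simp (disch := omega) only [labelClass, ↓if_pos, ↓if_neg]
    rw [labelState_pair]
  · obtain ⟨i, ⟨hi, hi'⟩, rfl⟩ := hv
    refine ⟨0, by omega, 0, by omega, i, by omega, ?_⟩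
    simp (disch := omega) only [labelClass, ↓if_pos, ↓if_neg]
    rw [labelState_singleton]
  · obtain ⟨i, ⟨hi, hi'⟩, rfl⟩ := hv
    refine ⟨0, by omega, i, by omega, 0, by omega, ?_⟩
    simp (disch := omega) only [labelClass, ↓if_pos, ↓if_neg]
    rw [labelState_singleton]
  · obtain ⟨i, ⟨hi, hi'⟩, rfl⟩ := hv
    refine ⟨i, by omega, 0, by omega, 0, by omega, ?_⟩
    simp (disch := omega) only [labelClass, ↓if_pos, ↓if_neg]
    rw [labelState_singleton]
  · obtain ⟨i, ⟨hi, hi'⟩, rfl⟩ := hv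
    refine ⟨i - 1, by omega, i - 1, by omega, i - 1, by omega, ?_⟩
    simp (disch := omega) only [labelClass, ↓if_pos, ↓if_neg]
    rw [labelState_pair, show i - 1 + 1 = i by omega]
  · obtain ⟨i, ⟨hi, hi'⟩, rfl⟩ := hv
    refine ⟨i - 1, by omega, i - 1, by omega, i - 1, by omega, ?_⟩
    simp (disch := omega) only [labelClass, ↓if_pos, ↓if_neg]
    rw [labelState_singleton]
  · obtain ⟨i, ⟨hi, hi'⟩, j, ⟨hj, hj'⟩, k, ⟨hk, hk'⟩, hne, rfl⟩ := hv
    refine ⟨i, by omega, j, by omega, k, by omega, ?_⟩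
    simp (disch := omega) only [labelClass, interiorClass, ↓if_pos, ↓if_neg]
    rw [labelState_quadruple]
  · obtain ⟨i, ⟨hi, hi'⟩, j, ⟨hj, hj'⟩, k, ⟨hk, hk'⟩, rfl⟩ := hv
    refine ⟨i, by omega, j, by omega, k, by omega, ?_⟩
    simp (disch := omega) only [labelClass, interiorClass, ↓if_pos, ↓if_neg]
    rw [labelState_triple]
  · obtain ⟨i, ⟨hi, hi'⟩, j, ⟨hj, hj'⟩, k, ⟨hk, hk'⟩, rfl⟩ := hv
    refine ⟨i, by omega, j, by omega, k, by omega, ?_⟩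
    simp (disch := omega) only [labelClass, interiorClass, ↓if_pos, ↓if_neg]
    rw [labelState_triple]
  · obtain ⟨i, ⟨hi, hi'⟩, j, ⟨hj, hj'⟩, k, ⟨hk, hk'⟩, rfl⟩ := hv
    refine ⟨i, by omega, j, by omega, k, by omega, ?_⟩
    simp (disch := omega) only [labelClass, interiorClass, ↓if_pos, ↓if_neg]
    rw [labelState_triple]
  · obtain ⟨i, ⟨hi, hi'⟩, j, ⟨hj, hj'⟩, k, ⟨hk, hk'⟩, rfl⟩ := hv
    refine ⟨i, by omega, j, by omega, k, by omega, ?_⟩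
    simp (disch := omega) only [labelClass, interiorClass, ↓if_pos, ↓if_neg]
    rw [labelState_triple]
  · obtain ⟨i, ⟨hi, hi'⟩, j, ⟨hj, hj'⟩, k, ⟨hk, hk'⟩, rfl⟩ := hv
    refine ⟨i, by omega, j, by omega, k, by omega, ?_⟩
    simp (disch := omega) only [labelClass, interiorClass, ↓if_pos, ↓if_neg]
    rw [labelState_triple]
  · obtain ⟨i, ⟨hi, hi'⟩, j, ⟨hj, hj'⟩, k, ⟨hk, hk'⟩, rfl⟩ := hv
    refine ⟨i, by omega, j, by omega, k, by omega, ?_⟩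
    simp (disch := omega) only [labelClass, interiorClass, ↓if_pos, ↓if_neg]
    rw [labelState_triple]
  · obtain ⟨i, ⟨hi, hi'⟩, j, ⟨hj, hj'⟩, k, ⟨hk, hk'⟩, rfl⟩ := hv
    refine ⟨i, by omega, j, by omega, k, by omega, ?_⟩
    simp (disch := omega) only [labelClass, interiorClass, ↓if_pos, ↓if_neg]
    rw [labelState_triple]
  · obtain ⟨i, ⟨hi, hi'⟩, j, ⟨hj, hj'⟩, k, ⟨hk, hk'⟩, rfl⟩ := hv
    refine ⟨i, by omega, j, by omega, k, by omega, ?_⟩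
    simp (disch := omega) only [labelClass, interiorClass, ↓if_pos, ↓if_neg]
    rw [labelState_pair]
  · obtain ⟨i, ⟨hi, hi'⟩, j, ⟨hj, hj'⟩, k, ⟨hk, hk'⟩, rfl⟩ := hv
    refine ⟨i, by omega, j, by omega, k, by omega, ?_⟩
    simp (disch := omega) only [labelClass, interiorClass, ↓if_pos, ↓if_neg]
    rw [labelState_pair]
  · obtain ⟨i, ⟨hi, hi'⟩, j, ⟨hj, hj'⟩, k, ⟨hk, hk'⟩, rfl⟩ := hv
    refine ⟨i, by omega, j, by omega, k, by omega, ?_⟩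
    simp (disch := omega) only [labelClass, interiorClass, ↓if_pos, ↓if_neg]
    rw [labelState_pair]
  · obtain ⟨i, ⟨hi, hi'⟩, j, ⟨hj, hj'⟩, k, ⟨hk, hk'⟩, rfl⟩ := hv
    refine ⟨i, by omega, j, by omega, k, by omega, ?_⟩
    simp (disch := omega) only [labelClass, interiorClass, ↓if_pos, ↓if_neg]
    rw [labelState_pair]
  · obtain ⟨i, ⟨hi, hi'⟩, j, ⟨hj, hj'⟩, k, ⟨hk, hk'⟩, rfl⟩ := hv
    refine ⟨i, by omega, j, by omega, k, by omega, ?_⟩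
    simp (disch := omega) only [labelClass, interiorClass, ↓if_pos, ↓if_neg]
    rw [labelState_pair]
  · obtain ⟨i, ⟨hi, hi'⟩, j, ⟨hj, hj'⟩, rfl⟩ := hv
    refine ⟨d₂ - 1, by omega, i, by omega, j, by omega, ?_⟩
    simp (disch := omega) only [labelClass, interiorClass, ↓if_pos, ↓if_neg]
    rw [labelState_pair]
  · obtain ⟨i, ⟨hi, hi'⟩, j, ⟨hj, hj'⟩, k, ⟨hk, hk'⟩, rfl⟩ := hv
    refine ⟨i, by omega, j, by omega, k, by omega, ?_⟩
    simp (disch := omega) only [labelClass, interiorClass, ↓if_neg]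
    rw [labelState_singleton]
  · obtain ⟨i, ⟨hi, hi'⟩, j, ⟨hj, hj'⟩, k, ⟨hk, hk'⟩, rfl⟩ := hv
    refine ⟨i, by omega, j, by omega, k, by omega, ?_⟩
    simp (disch := omega) only [labelClass, interiorClass, ↓if_pos, ↓if_neg]
    rw [labelState_singleton]
  · obtain ⟨i, ⟨hi, hi'⟩, j, ⟨hj, hj'⟩, k, ⟨hk, hk'⟩, hne, rfl⟩ := hv
    refine ⟨i, by omega, j, by omega, k, by omega, ?_⟩
    simp (disch := omega) only [labelClass, interiorClass, ↓if_neg]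
    rw [labelState_singleton]

end States

/-! ### The main theorem -/

section Main

variable {d₁ d₂ d₃ d₄ : ℕ}

/-- The label of a basis vector of the four-partite system. -/
def toLabel (x : (p : Fin 4) → Fin (![d₁, d₂, d₃, d₄] p)) : Label := (x 0, x 1, x 2, x 3)

theorem toLabel_eq_iff (x : (p : Fin 4) → Fin (![d₁, d₂, d₃, d₄] p)) (a b c e : ℕ) :
    toLabel x = (a, b, c, e) ↔
      (x 0 : ℕ) = a ∧ (x 1 : ℕ) = b ∧ (x 2 : ℕ) = c ∧ (x 3 : ℕ) = e := by
  simp [toLabel]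

theorem toLabel_injective :
    Function.Injective (toLabel : ((p : Fin 4) → Fin (![d₁, d₂, d₃, d₄] p)) → Label) := by
  intro x y h
  simp only [toLabel, Prod.mk.injEq] at h
  ext p
  match p with
  | 0 => exact h.1
  | 1 => exact h.2.1
  | 2 => exact h.2.2.1
  | 3 => exact h.2.2.2

theorem toLabel_update_zero (x : (p : Fin 4) → Fin (![d₁, d₂, d₃, d₄] p))
    (a : Fin (![d₁, d₂, d₃, d₄] 0)) :
    toLabel (Function.update x 0 a) = ((a : ℕ), (toLabel x).2) := rfl

theorem toLabel_update_one (x : (p : Fin 4) → Fin (![d₁, d₂, d₃, d₄] p))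
    (a : Fin (![d₁, d₂, d₃, d₄] 1)) :
    toLabel (Function.update x 1 a) = ((toLabel x).1, (a : ℕ), (toLabel x).2.2) := rfl

theorem toLabel_update_two (x : (p : Fin 4) → Fin (![d₁, d₂, d₃, d₄] p))
    (a : Fin (![d₁, d₂, d₃, d₄] 2)) :
    toLabel (Function.update x 2 a) =
      ((toLabel x).1, (toLabel x).2.1, (a : ℕ), (toLabel x).2.2.2) := rfl

theorem toLabel_update_three (x : (p : Fin 4) → Fin (![d₁, d₂, d₃, d₄] p))
    (a : Fin (![d₁, d₂, d₃, d₄] 3)) :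
    toLabel (Function.update x 3 a) =
      ((toLabel x).1, (toLabel x).2.1, (toLabel x).2.2.1, (a : ℕ)) := rfl

theorem exists_toLabel {t : Label} (ha : t.1 < d₁) (hb : t.2.1 < d₂) (hc : t.2.2.1 < d₃)
    (he : t.2.2.2 < d₄) :
    ∃ x : (p : Fin 4) → Fin (![d₁, d₂, d₃, d₄] p), toLabel x = t :=
  ⟨fun p => match p with
    | 0 => ⟨t.1, ha⟩
    | 1 => ⟨t.2.1, hb⟩
    | 2 => ⟨t.2.2.1, hc⟩
    | 3 => ⟨t.2.2.2, he⟩, rfl⟩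

theorem ket_toLabel (x : (p : Fin 4) → Fin (![d₁, d₂, d₃, d₄] p)) :
    ket (toLabel x).1 (toLabel x).2.1 (toLabel x).2.2.1 (toLabel x).2.2.2 =
      EuclideanSpace.single x (1 : ℂ) := by
  ext y
  have : y = x ↔ toLabel y = (toLabel x) := toLabel_injective.eq_iff.symm
  rw [PiLp.single_apply]
  simp only [ket, this]
  congr 1
  simp [toLabel]

/-- The set of basis labels occurring in a list. -/
def support (d₁ d₂ d₃ d₄ : ℕ) (l : List Label) :
    Finset ((p : Fin 4) → Fin (![d₁, d₂, d₃, d₄] p)) :=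
  Finset.univ.filter fun x => toLabel x ∈ l

theorem mem_support {l : List Label} {x : (p : Fin 4) → Fin (![d₁, d₂, d₃, d₄] p)} :
    x ∈ support d₁ d₂ d₃ d₄ l ↔ toLabel x ∈ l := by simp [support]

/-- Without repetitions and with all labels in range, list length and cardinality agree, so the
normalisations do too. -/
theorem uniform_support {l : List Label} (hl : l.Nodup)
    (h : ∀ t ∈ l, t.1 < d₁ ∧ t.2.1 < d₂ ∧ t.2.2.1 < d₃ ∧ t.2.2.2 < d₄) :
    uniform (support d₁ d₂ d₃ d₄ l) = labelState l := by
  have himg : (support d₁ d₂ d₃ d₄ l).image toLabel = l.toFinset := by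
    ext t
    simp only [Finset.mem_image, mem_support, List.mem_toFinset]
    constructor
    · rintro ⟨x, hx, rfl⟩
      exact hx
    · intro ht
      obtain ⟨ha, hb, hc, he⟩ := h t ht
      obtain ⟨x, rfl⟩ := exists_toLabel ha hb hc he
      exact ⟨x, ht, rfl⟩
  have hcard : (support d₁ d₂ d₃ d₄ l).card = l.length := by
    rw [← List.toFinset_card_of_nodup hl, ← himg, Finset.card_image_of_injective _
        toLabel_injective]
  rw [uniform, labelState, hcard, ← List.sum_toFinset _ hl, ← himg,
    Finset.sum_image fun x _ y _ h => toLabel_injective h]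
  simp only [ket_toLabel]

/-- The sets of basis labels of the states of the construction. -/
def classSupport (d₁ d₂ d₃ d₄ : ℕ) (j : Fin d₂ × Fin d₃ × Fin d₄) :
    Finset ((p : Fin 4) → Fin (![d₁, d₂, d₃, d₄] p)) :=
  support d₁ d₂ d₃ d₄ (labelClass d₁ d₂ d₃ j.1 j.2.1 j.2.2)

theorem mem_classSupport {j : Fin d₂ × Fin d₃ × Fin d₄}
    {x : (p : Fin 4) → Fin (![d₁, d₂, d₃, d₄] p)} :
    x ∈ classSupport d₁ d₂ d₃ d₄ j ↔ toLabel x ∈ labelClass d₁ d₂ d₃ j.1 j.2.1 j.2.2 := mem_support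

theorem uniform_classSupport (h₁ : 2 ≤ d₁) (h₁₂ : d₁ < d₂) (h₂₃ : d₂ ≤ d₃) (h₃₄ : d₃ ≤ d₄)
    (j : Fin d₂ × Fin d₃ × Fin d₄) :
    uniform (classSupport d₁ d₂ d₃ d₄ j) =
      labelState (labelClass d₁ d₂ d₃ j.1 j.2.1 j.2.2) := by
  refine uniform_support (nodup_labelClass h₁ h₁₂) fun t ht => ?_
  obtain ⟨ha, hb, hc, he, -⟩ :=
    labelClass_lt h₁ h₁₂ h₂₃ h₃₄ j.1.2 j.2.1.2 j.2.2.2 ht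
  exact ⟨ha, hb, hc, he⟩

/-- Replaces the 36 families by one family indexed by `Fin d₂ × Fin d₃ × Fin d₄`; as distinct
indices give distinct states, the cardinality follows. -/
theorem alphaSet_eq_range (h₁ : 2 ≤ d₁) (h₁₂ : d₁ < d₂) (h₂₃ : d₂ ≤ d₃) (h₃₄ : d₃ ≤ d₄) :
    alphaSet d₁ d₂ d₃ d₄ = Set.range fun j => uniform (classSupport d₁ d₂ d₃ d₄ j) := by
  ext v
  simp only [Set.mem_range, uniform_classSupport h₁ h₁₂ h₂₃ h₃₄]
  constructor
  · intro hv
    obtain ⟨b, hb, c, hc, e, he, rfl⟩ := exists_labelClass_of_mem h₁ h₁₂ h₂₃ h₃₄ hv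
    exact ⟨(⟨b, hb⟩, ⟨c, hc⟩, ⟨e, he⟩), rfl⟩
  · rintro ⟨j, rfl⟩
    exact labelClass_state_mem h₁ h₁₂ h₂₃ j.1.2 j.2.1.2 j.2.2.2

theorem classSupport_disjoint (h₁ : 2 ≤ d₁) (h₁₂ : d₁ < d₂) (h₂₃ : d₂ ≤ d₃) ⦃j k⦄
    ⦃x : (p : Fin 4) → Fin (![d₁, d₂, d₃, d₄] p)⦄ (hj : x ∈ classSupport d₁ d₂ d₃ d₄ j)
    (hk : x ∈ classSupport d₁ d₂ d₃ d₄ k) : j = k := by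
  rw [mem_classSupport] at hj hk
  have h := (classIndex_of_mem h₁ h₁₂ h₂₃ j.1.2 j.2.1.2 hj).symm.trans
    (classIndex_of_mem h₁ h₁₂ h₂₃ k.1.2 k.2.1.2 hk)
  simp only [Prod.mk.injEq] at h
  exact Prod.ext (Fin.ext h.1) (Prod.ext (Fin.ext h.2.1) (Fin.ext h.2.2))

theorem classSupport_nonempty (h₁ : 2 ≤ d₁) (h₁₂ : d₁ < d₂) (h₂₃ : d₂ ≤ d₃) (h₃₄ : d₃ ≤ d₄)
    (j : Fin d₂ × Fin d₃ × Fin d₄) : (classSupport d₁ d₂ d₃ d₄ j).Nonempty := by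
  obtain ⟨t, ht⟩ : ∃ t, t ∈ labelClass d₁ d₂ d₃ j.1 j.2.1 j.2.2 := by
    by_cases h : ((j.1 : ℕ), (j.2.1 : ℕ), (j.2.2 : ℕ)) = (0, 0, 0)
    · simp only [Prod.mk.injEq] at h
      exact ⟨(1, 0, 0, 0), by simp [labelClass, h]⟩
    · exact ⟨_, zero_mem_labelClass h⟩
  obtain ⟨ha, hb, hc, he, -⟩ := labelClass_lt h₁ h₁₂ h₂₃ h₃₄ j.1.2 j.2.1.2 j.2.2.2 ht
  obtain ⟨x, rfl⟩ := exists_toLabel ha hb hc he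
  exact ⟨x, mem_classSupport.mpr ht⟩

theorem isRanked_classSupport (h₁ : 2 ≤ d₁) (h₁₂ : d₁ < d₂) (h₂₃ : d₂ ≤ d₃) (h₃₄ : d₃ ≤ d₄)
    {o : (p : Fin 4) → Fin (![d₁, d₂, d₃, d₄] p)} (ho : toLabel o = (0, 0, 0, 0)) (p : Fin 4) :
    IsRanked (classSupport d₁ d₂ d₃ d₄) o (fun x => labelRank (toLabel x)) p := by
  have ho' := (toLabel_eq_iff o 0 0 0 0).mp ho
  refine ⟨classSupport_disjoint h₁ h₁₂ h₂₃, ?_, ?_, ?_⟩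
  · intro x hp hx
    rw [← toLabel_injective.ne_iff, ho] at hx
    have h0 : (x 0 : ℕ) = 0 ∨ (x 1 : ℕ) = 0 ∨ (x 2 : ℕ) = 0 ∨ (x 3 : ℕ) = 0 := by
      match p with
      | 0 => exact .inl (by rw [hp, ho'.1])
      | 1 => exact .inr (.inl (by rw [hp, ho'.2.1]))
      | 2 => exact .inr (.inr (.inl (by rw [hp, ho'.2.2.1])))
      | 3 => exact .inr (.inr (.inr (by rw [hp, ho'.2.2.2])))
    obtain ⟨b, hb, c, hc, e, he, h⟩ :=
      exists_mem_labelClass h₁ h₁₂ h₂₃ h₃₄ hx (x 0).2 (x 1).2 (x 2).2 (x 3).2 h0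
    exact ⟨(⟨b, hb⟩, ⟨c, hc⟩, ⟨e, he⟩), mem_classSupport.mpr h⟩
  · intro j x y hx hy hxy hp
    rw [mem_classSupport] at hx hy
    have h := labelClass_isolated h₁ h₁₂ hx hy (toLabel_injective.ne hxy)
    simp only [toLabel] at h
    rw [Ne, Fin.ext_iff]
    rw [Fin.ext_iff] at hp
    match p with
    | 0 => rw [ho'.1] at hp ⊢; exact h.1 hp
    | 1 => rw [ho'.2.1] at hp ⊢; exact h.2.1 hp
    | 2 => rw [ho'.2.2.1] at hp ⊢; exact h.2.2.1 hp
    | 3 => rw [ho'.2.2.2] at hp ⊢; exact h.2.2.2 hp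
  · intro j x y hx hy hxy hp
    rw [mem_classSupport] at hx hy
    have h := labelRank_lt h₁ h₁₂ hx hy (toLabel_injective.ne hxy)
    rw [Fin.ext_iff] at hp
    match p with
    | 0 =>
      rw [ho'.1] at hp
      simp only [toLabel_update_zero, ho'.1]
      exact h.1 hp
    | 1 =>
      rw [ho'.2.1] at hp
      simp only [toLabel_update_one, ho'.2.1]
      exact h.2.1 hp
    | 2 =>
      rw [ho'.2.2.1] at hp
      simp only [toLabel_update_two, ho'.2.2.1]
      exact h.2.2.1 hp
    | 3 =>
      rw [ho'.2.2.2] at hp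
      simp only [toLabel_update_three, ho'.2.2.2]
      exact h.2.2.2 hp

/-- These are the four product states of the first family, one for each possible untouched party. -/
theorem exists_classSupport_eq_update (h₁ : 2 ≤ d₁) (h₁₂ : d₁ < d₂) (h₂₃ : d₂ ≤ d₃) (h₃₄ : d₃ ≤ d₄)
    {o : (p : Fin 4) → Fin (![d₁, d₂, d₃, d₄] p)} (ho : toLabel o = (0, 0, 0, 0)) (p : Fin 4) :
    ∃ j a, classSupport d₁ d₂ d₃ d₄ j = {Function.update o p a} := by
  have ho' := (toLabel_eq_iff o 0 0 0 0).mp ho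
  have key : ∀ b c e (hb : b < d₂) (hc : c < d₃) (he : e < d₄)
      (x : (p : Fin 4) → Fin (![d₁, d₂, d₃, d₄] p)),
      labelClass d₁ d₂ d₃ b c e = [toLabel x] →
      classSupport d₁ d₂ d₃ d₄ (⟨b, hb⟩, ⟨c, hc⟩, ⟨e, he⟩) = {x} := by
    intro b c e hb hc he x h
    ext y
    rw [mem_classSupport, h, List.mem_singleton, Finset.mem_singleton, toLabel_injective.eq_iff]
  match p with
  | 0 =>
    exact ⟨_, ⟨1, show 1 < d₁ by omega⟩, key 0 0 0 (by omega) (by omega) (by omega) _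
      (by rw [toLabel_update_zero, ho]; simp [labelClass])⟩
  | 1 =>
    exact ⟨_, ⟨1, show 1 < d₂ by omega⟩, key 1 0 0 (by omega) (by omega) (by omega) _
      (by rw [toLabel_update_one, ho]; simp [labelClass])⟩
  | 2 =>
    exact ⟨_, ⟨1, show 1 < d₃ by omega⟩, key 0 1 0 (by omega) (by omega) (by omega) _
      (by rw [toLabel_update_two, ho]; simp [labelClass])⟩
  | 3 =>
    exact ⟨_, ⟨1, show 1 < d₄ by omega⟩, key 0 0 1 (by omega) (by omega) (by omega) _
      (by rw [toLabel_update_three, ho]; simp [labelClass])⟩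

theorem psi_eq_originDft {o : (p : Fin 4) → Fin (![d₁, d₂, d₃, d₄] p)}
    (ho : toLabel o = (0, 0, 0, 0)) (N : ℕ) (α : ℕ → Hilb ![d₁, d₂, d₃, d₄]) :
    psi N α = originDft N o α := by
  have := ket_toLabel o
  rw [ho] at this
  funext i
  rw [psi, originDft, this, dft]

theorem conjecturedBound_eq (h₁₂ : d₁ < d₂) (h₂₃ : d₂ ≤ d₃) (h₃₄ : d₃ ≤ d₄) :
    conjecturedBound ![d₁, d₂, d₃, d₄] = d₂ * d₃ * d₄ + 1 := by
  have e0 : (Finset.univ : Finset (Fin 4)).erase 0 = {1, 2, 3} := by decide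
  have e1 : (Finset.univ : Finset (Fin 4)).erase 1 = {0, 2, 3} := by decide
  have e2 : (Finset.univ : Finset (Fin 4)).erase 2 = {0, 1, 3} := by decide
  have e3 : (Finset.univ : Finset (Fin 4)).erase 3 = {0, 1, 2} := by decide
  apply le_antisymm
  · refine Finset.sup_le fun p _ => Nat.succ_le_succ ?_
    match p with
    | 0 => rw [e0]; simp [mul_assoc]
    | 1 =>
      rw [e1]
      simp only [Finset.mem_insert, Finset.mem_singleton, Fin.reduceEq, or_self, not_false_eq_true,
        Finset.prod_insert, Finset.prod_singleton]
      change d₁ * (d₃ * d₄) ≤ _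
      rw [mul_assoc]
      gcongr
    | 2 =>
      rw [e2]
      simp only [Finset.mem_insert, Finset.mem_singleton, Fin.reduceEq, or_self, not_false_eq_true,
        Finset.prod_insert, Finset.prod_singleton]
      change d₁ * (d₂ * d₄) ≤ _
      rw [mul_assoc]
      gcongr
    | 3 =>
      rw [e3]
      simp only [Finset.mem_insert, Finset.mem_singleton, Fin.reduceEq, or_self, not_false_eq_true,
        Finset.prod_insert, Finset.prod_singleton]
      change d₁ * (d₂ * d₃) ≤ _
      rw [mul_assoc]
      gcongr
  -- The maximum is attained by omitting the first party, whose dimension is smallest.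
  · refine le_trans (le_of_eq ?_) (Finset.le_sup (Finset.mem_univ 0))
    rw [e0]
    simp [mul_assoc]

end Main

end StrongestNonlocality

end

/-! ### Assembly: the criterion applied to the label classes -/

open StrongestNonlocality in
theorem mainTheorem2 (d₁ d₂ d₃ d₄ : ℕ) (h₁ : 2 ≤ d₁) (h₁₂ : d₁ < d₂) (h₂₃ : d₂ ≤ d₃)
    (h₃₄ : d₃ ≤ d₄) :
    (StrongestNonlocality.alphaSet d₁ d₂ d₃ d₄).ncard = d₂ * d₃ * d₄ ∧
    (∀ α : ℕ → StrongestNonlocality.Hilb ![d₁, d₂, d₃, d₄],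
      Set.BijOn α (Set.Icc 1 (d₂ * d₃ * d₄)) (StrongestNonlocality.alphaSet d₁ d₂ d₃ d₄) →
        (StrongestNonlocality.psiSet (d₂ * d₃ * d₄) α).ncard = d₂ * d₃ * d₄ + 1 ∧
        StrongestNonlocality.IsStrongestNonlocal ![d₁, d₂, d₃, d₄]
          (StrongestNonlocality.psiSet (d₂ * d₃ * d₄) α)) ∧
    d₂ * d₃ * d₄ + 1 = StrongestNonlocality.conjecturedBound ![d₁, d₂, d₃, d₄] := by
  have hne := classSupport_nonempty h₁ h₁₂ h₂₃ h₃₄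
  have hdisj := classSupport_disjoint (d₄ := d₄) h₁ h₁₂ h₂₃
  have hN : d₂ * d₃ * d₄ ≠ 0 := by
    have h2 : d₂ ≠ 0 := by omega
    have h3 : d₃ ≠ 0 := by omega
    have h4 : d₄ ≠ 0 := by omega
    positivity
  obtain ⟨o, ho⟩ : ∃ o : (p : Fin 4) → Fin (![d₁, d₂, d₃, d₄] p), toLabel o = (0, 0, 0, 0) :=
    exists_toLabel (by simp only; omega) (by simp only; omega) (by simp only; omega)
      (by simp only; omega)
  have hoC : ∀ j, o ∉ classSupport d₁ d₂ d₃ d₄ j := by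
    intro j hj
    rw [mem_classSupport] at hj
    exact (labelClass_lt h₁ h₁₂ h₂₃ h₃₄ j.1.2 j.2.1.2 j.2.2.2 hj).2.2.2.2 ho
  rw [alphaSet_eq_range h₁ h₁₂ h₂₃ h₃₄]
  refine ⟨?_, fun α hα => ?_, (conjecturedBound_eq h₁₂ h₂₃ h₃₄).symm⟩
  · rw [← Set.image_univ, (uniform_injective hne hdisj).injOn.ncard_image, Set.ncard_univ]
    simp [mul_assoc]
  · rw [psiSet, psi_eq_originDft ho]
    exact ⟨ncard_originDft hN hne hdisj hoC hα,
      isStrongestNonlocal_originDft hN hne hoC (isRanked_classSupport h₁ h₁₂ h₂₃ h₃₄ ho) hdisj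
        (exists_classSupport_eq_update h₁ h₁₂ h₂₃ h₃₄ ho) hα⟩
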